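/- Write $[\![n]\!]=\{0,\dots,n-1\}$. A map $m:[\![n]\!]\to\{0,1\}$ is \emph{one-hot} if $m(x)=1$ for exactly one $x$. Let $\Gamma$ be a finite Boolean constraint language, i.e. a finite set of relations $R\subseteq\{0,1\}^r$ (of possibly different arities $r$). An instance of \textsc{One-Hot-CSP}$(\Gamma)$ is a triple $(n,V,C)$ consisting of a domain size $n$ given in unary, a finite set $V$ of variables, and a finite set $C$ of constraints $R(m_1(v_1),\dots,m_r(v_r))$, where $R\in\Gamma$ has arity $r$, $v_1,\dots,v_r\in V$, and $m_1,\dots,m_r:[\![n]\!]\to\{0,1\}$ are one-hot maps. The question is whether there is an assignment $f:V\to[\![n]\!]$ with $(m_1(f(v_1)),\dots,m_r(f(v_r)))\in R$ for every constraint in $C$. The parameter is $|V|$. The language $\Gamma$ is \emph{weakly $0$-separable} if every $R\in\Gamma$ is invariant under the two partial operations on $\{0,1\}$ given by $$f(0,0,0)=0,\quad f(0,0,1)=f(0,1,0)=f(1,1,1)=1,$$ $$g(0,0,0)=g(0,1,1)=0,\quad g(0,0,1)=g(1,1,1)=1$$ and undefined on all other arguments; here $R$ is invariant under a partial operation $h$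 if, for all $t_1,t_2,t_3\in R$ such that $h$ is defined in every coordinate, the tuple $h(t_1,t_2,t_3)$ computed coordinatewise belongs to $R$. A parameterized problem $L\subseteq\Sigma^*\times\mathbb N$ ($\Sigma$ a finite alphabet) is in \emph{FPT} if membership of $(x,k)$ in $L$ can be decided in time $f(k)\cdot|x|^{O(1)}$ for some computable function $f$. An \emph{FPT-reduction} from $L_1$ to $L_2$ is a map $P$, computable in time $f(k)\cdot|x|^{O(1)}$ for some computable $f$, such that $(x,k)\in L_1$ if and only if $P(x,k)\in L_2$, and such that, for some computable function $g$, the parameter of $P(x,k)$ is at most $g(k)$. The class W[1] consists of all problems that FPT-reduce to \textsc{Independent Set} parameterized by the solution size, and a problem is \emph{W[1]-hard} if every problem in W[1] FPT-reduces to it. \textbf{Theorem.} Let $\Gamma$ be a finite Boolean constraint language. If $\Gamma$ is weakly $0$-separable, then \textsc{One-Hot-CSP}$(\Gamma)$, parameterized by the number of variables, is in FPT. Otherwise, it is W[1]-hard. -/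

import Mathlib

namespace UDCSP

/-! ## A machine model with a step count -/

/-- The values that programs work on: binary trees. They are immutable and shared by reference,
so that copying, building one node, and reading a child are elementary steps (a pure LISP /
pointer machine, which is polynomially equivalent to Turing machines: `t` steps create at most `t`
new nodes). -/
inductive Data : Type
  | nil : Data
  | cons : Data → Data → Data

namespace Data

/-- Left child; the left child of `nil` is `nil`. -/
def hd : Data → Data
  | nil => nil
  | cons a _ => a

/-- Right child; the right child of `nil` is `nil`. -/
def tl : Data → Data
  | nil => nil
  | cons _ b => b

/-- The natural number `m` as a chain of `m` nodes. -/
def ofNat : ℕ → Data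
  | 0 => nil
  | m + 1 => cons nil (ofNat m)

/-- A string over the alphabet `{0, …, s - 1}` as a list of its letters. -/
def ofString {s : ℕ} : List (Fin s) → Data
  | [] => nil
  | a :: w => cons (ofNat a) (ofString w)

/-- A string together with the value of the parameter. -/
def ofInput {s : ℕ} (x : List (Fin s) × ℕ) : Data :=
  cons (ofString x.1) (ofNat x.2)

end Data

/-- WHILE programs over binary trees, each transforming one tree into another one. -/
inductive Prog : Type
  /-- return the input -/
  | skip : Prog
  /-- return the tree `nil` -/
  | nil : Prog
  /-- return the left child of the input -/
  | hd : Prog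
  /-- return the right child of the input -/
  | tl : Prog
  /-- run both programs on the input and return the pair of the two results -/
  | cons : Prog → Prog → Prog
  /-- run the first program, then the second one on its result -/
  | seq : Prog → Prog → Prog
  /-- `cond c p q`: if `c` returns a tree other than `nil` then run `p`, else run `q` -/
  | cond : Prog → Prog → Prog → Prog
  /-- `loop c p`: while `c` returns a tree other than `nil`, apply `p` -/
  | loop : Prog → Prog → Prog

/-- `Run p x y t`: on input `x` the program `p` halts with result `y` after exactly `t` elementary
steps. -/
inductive Run : Prog → Data → Data → ℕ → Prop
  | skip (x : Data) : Run Prog.skip x x 1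
  | nil (x : Data) : Run Prog.nil x Data.nil 1
  | hd (x : Data) : Run Prog.hd x x.hd 1
  | tl (x : Data) : Run Prog.tl x x.tl 1
  | cons {p q : Prog} {x y z : Data} {t u : ℕ} :
      Run p x y t → Run q x z u → Run (Prog.cons p q) x (Data.cons y z) (t + u + 1)
  | seq {p q : Prog} {x y z : Data} {t u : ℕ} :
      Run p x y t → Run q y z u → Run (Prog.seq p q) x z (t + u + 1)
  | cond_true {c p q : Prog} {x a b y : Data} {t u : ℕ} :
      Run c x (Data.cons a b) t → Run p x y u → Run (Prog.cond c p q) x y (t + u + 1)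
  | cond_false {c p q : Prog} {x y : Data} {t u : ℕ} :
      Run c x Data.nil t → Run q x y u → Run (Prog.cond c p q) x y (t + u + 1)
  | loop_done {c p : Prog} {x : Data} {t : ℕ} :
      Run c x Data.nil t → Run (Prog.loop c p) x x (t + 1)
  | loop_step {c p : Prog} {x a b y z : Data} {t u v : ℕ} :
      Run c x (Data.cons a b) t → Run p x y u → Run (Prog.loop c p) y z v →
        Run (Prog.loop c p) x z (t + u + v + 1)

/-- Programs are deterministic: the result and the number of steps are determined by the input. -/
theorem Run.deterministic {p : Prog} {x y y' : Data} {t t' : ℕ}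
    (h : Run p x y t) (h' : Run p x y' t') : y = y' ∧ t = t' := by
  induction h generalizing y' t' with
  | skip | nil | hd | tl => cases h'; exact ⟨rfl, rfl⟩
  | cons _ _ ih₁ ih₂ =>
    cases h' with
    | cons a b => exact ⟨by rw [(ih₁ a).1, (ih₂ b).1], by rw [(ih₁ a).2, (ih₂ b).2]⟩
  | seq _ _ ih₁ ih₂ =>
    cases h' with
    | seq a b =>
      obtain ⟨rfl, rfl⟩ := ih₁ a
      exact ⟨(ih₂ b).1, by rw [(ih₂ b).2]⟩
  | cond_true _ _ ih₁ ih₂ =>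
    cases h' with
    | cond_true a b => exact ⟨(ih₂ b).1, by rw [(ih₁ a).2, (ih₂ b).2]⟩
    | cond_false a _ => cases (ih₁ a).1
  | cond_false _ _ ih₁ ih₂ =>
    cases h' with
    | cond_true a _ => cases (ih₁ a).1
    | cond_false a b => exact ⟨(ih₂ b).1, by rw [(ih₁ a).2, (ih₂ b).2]⟩
  | loop_done _ ih =>
    cases h' with
    | loop_done a => exact ⟨rfl, by rw [(ih a).2]⟩
    | loop_step a _ _ => cases (ih a).1
  | loop_step _ _ _ ih₁ ih₂ ih₃ =>
    cases h' with
    | loop_done a => cases (ih₁ a).1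
    | loop_step a b c =>
      obtain ⟨rfl, rfl⟩ := ih₂ b
      exact ⟨(ih₃ c).1, by rw [(ih₁ a).2, (ih₃ c).2]⟩

/-! ## Parameterized complexity -/

/-- A parameterized problem over the alphabet `{0, …, s - 1}`: a subset of `Σ* × ℕ`. -/
abbrev ParamProblem (s : ℕ) : Type := Set (List (Fin s) × ℕ)

/-- `L` is fixed-parameter tractable: some program decides `(w, k) ∈ L` (a result other than `nil`
means yes) in at most `f k * (|w| + 1) ^ c` steps, where `f` is computable and `c` constant. -/
def FPT {s : ℕ} (L : ParamProblem s) : Prop :=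
  ∃ (p : Prog) (f : ℕ → ℕ) (c : ℕ), Computable f ∧
    ∀ (w : List (Fin s)) (k : ℕ), ∃ (y : Data) (t : ℕ),
      Run p (Data.ofInput (w, k)) y t ∧ t ≤ f k * (w.length + 1) ^ c ∧
        (y ≠ Data.nil ↔ (w, k) ∈ L)

/-- There is an FPT-reduction `P` from `L₁` to `L₂`. -/
def FPTReducible {s₁ s₂ : ℕ} (L₁ : ParamProblem s₁) (L₂ : ParamProblem s₂) : Prop :=
  ∃ P : List (Fin s₁) × ℕ → List (Fin s₂) × ℕ,
    (∀ x, x ∈ L₁ ↔ P x ∈ L₂) ∧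
    (∃ (p : Prog) (f : ℕ → ℕ) (c : ℕ), Computable f ∧
      ∀ (w : List (Fin s₁)) (k : ℕ), ∃ t : ℕ,
        Run p (Data.ofInput (w, k)) (Data.ofInput (P (w, k))) t ∧
          t ≤ f k * (w.length + 1) ^ c) ∧
    (∃ g : ℕ → ℕ, Computable g ∧ ∀ (w : List (Fin s₁)) (k : ℕ), (P (w, k)).2 ≤ g k)

/-- A list of natural numbers as a binary string, each number `a` being written `1 ⋯ 1 0` with `a`
ones. -/
def unaryCode (l : List ℕ) : List (Fin 2) :=
  l.flatMap fun a => List.replicate a 1 ++ [0]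

/-- The string `w` describes the graph `G`: it consists of the number of vertices followed by the
end points of the edges, in some order, with every edge listed at least once. -/
def EncodesGraph {n : ℕ} (w : List (Fin 2)) (G : SimpleGraph (Fin n)) : Prop :=
  ∃ E : List (Fin n × Fin n),
    w = unaryCode (n :: E.flatMap fun e => [(e.1 : ℕ), (e.2 : ℕ)]) ∧
      ∀ a b : Fin n, G.Adj a b ↔ (a, b) ∈ E ∨ (b, a) ∈ E

/-- Independent Set, parameterized by the size of the solution: given an undirected graph and an
integer `k ≥ 1`, is there an independent set of size `k`? -/
def IndependentSet : ParamProblem 2 :=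
  {x | 1 ≤ x.2 ∧ ∃ (n : ℕ) (G : SimpleGraph (Fin n)), EncodesGraph x.1 G ∧
    ∃ S : Finset (Fin n), G.IsNIndepSet x.2 S}

/-- The class W[1]: the problems that are FPT-reducible to Independent Set. -/
def W1 {s : ℕ} (L : ParamProblem s) : Prop :=
  FPTReducible L IndependentSet

/-- `L` is W[1]-hard: every problem in W[1], over any finite alphabet, FPT-reduces to it. -/
def W1Hard {s : ℕ} (L : ParamProblem s) : Prop :=
  ∀ (s' : ℕ) (L' : ParamProblem s'), W1 L' → FPTReducible L' L

/-! ## Constraint satisfaction with unbounded domains -/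

/-- A relation over the domain `{0, …, d - 1}`. -/
structure Rel (d : ℕ) where
  arity : ℕ
  tuples : Set (Fin arity → Fin d)

/-- A finite constraint language over the domain `{0, …, d - 1}`, given by a list of its
relations. -/
abbrev Language (d : ℕ) : Type := List (Rel d)

/-- A map family: for all `d` and `n` a set of maps from `{0, …, n - 1}` to `{0, …, d - 1}`. -/
abbrev MapFamily : Type := (d n : ℕ) → Set (Fin n → Fin d)

/-- A functionally guarded constraint `R(m₁(v₁), …, mᵣ(vᵣ))` over `k` variables with domain
`{0, …, n - 1}`. -/
structure Constraint {d : ℕ} (Γ : Language d) (M : MapFamily) (n k : ℕ) where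
  /-- the relation, by its position in the language -/
  rel : Fin Γ.length
  vars : Fin (Γ.get rel).arity → Fin k
  maps : Fin (Γ.get rel).arity → Fin n → Fin d
  maps_mem : ∀ i, maps i ∈ M d n

/-- An instance `(n, V, C)`: a domain size, `k` variables (`V = {0, …, k - 1}`), and
constraints. -/
structure Instance {d : ℕ} (Γ : Language d) (M : MapFamily) where
  n : ℕ
  k : ℕ
  constraints : List (Constraint Γ M n k)

namespace Instance

variable {d : ℕ} {Γ : Language d} {M : MapFamily}

/-- Some assignment of domain elements to the variables satisfies all constraints. -/
def Satisfiable (I : Instance Γ M) : Prop :=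
  ∃ f : Fin I.k → Fin I.n, ∀ c ∈ I.constraints,
    (fun i => c.maps i (f (c.vars i))) ∈ (Γ.get c.rel).tuples

/-- The instance as a binary string: domain size (in unary), number of variables, and for each
constraint its relation followed by its arguments, every argument being a variable followed by the
value table of its map. -/
def encode (I : Instance Γ M) : List (Fin 2) :=
  unaryCode (I.n :: I.k :: I.constraints.flatMap fun c =>
    (c.rel : ℕ) :: (List.finRange (Γ.get c.rel).arity).flatMap fun i =>
      (c.vars i : ℕ) :: List.ofFn fun a => (c.maps i a : ℕ))

end Instance

/-- `udCSP(Γ, M)`, parameterized by the number of variables. -/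
def udCSP {d : ℕ} (Γ : Language d) (M : MapFamily) : ParamProblem 2 :=
  {x | ∃ I : Instance Γ M, x.1 = I.encode ∧ x.2 = I.k ∧ I.Satisfiable}

/-- The family of one-hot maps: maps `m : {0, …, n - 1} → {0, 1}` with `m x = 1` for exactly
one `x`. -/
def OH : MapFamily := fun d n => {m | d = 2 ∧ ∃! x : Fin n, (m x : ℕ) = 1}

/-- `One-Hot-CSP(Γ)`, parameterized by the number of variables. -/
def OneHotCSP {d : ℕ} (Γ : Language d) : ParamProblem 2 := udCSP Γ OH

/-! ## Weak 0-separability -/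

/-- `R` is invariant under the ternary partial operation `g` (`none` means undefined), applied
componentwise to tuples of `R`. -/
def Rel.Preserves {d : ℕ} (R : Rel d) (g : Fin d → Fin d → Fin d → Option (Fin d)) : Prop :=
  ∀ t₁ ∈ R.tuples, ∀ t₂ ∈ R.tuples, ∀ t₃ ∈ R.tuples, ∀ t : Fin R.arity → Fin d,
    (∀ i, g (t₁ i) (t₂ i) (t₃ i) = some (t i)) → t ∈ R.tuples

/-- Union of two Boolean tuples that are disjoint outside of a common part. -/
def fNand : Fin 2 → Fin 2 → Fin 2 → Option (Fin 2)
  | 0, 0, 0 => some 0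
  | 0, 0, 1 => some 1
  | 0, 1, 0 => some 1
  | 1, 1, 1 => some 1
  | _, _, _ => none

/-- For Boolean tuples `t₁ ≤ t₂ ≤ t₃`: removal of `t₂ \ t₁` from `t₃`. -/
def gImpl : Fin 2 → Fin 2 → Fin 2 → Option (Fin 2)
  | 0, 0, 0 => some 0
  | 0, 1, 1 => some 0
  | 0, 0, 1 => some 1
  | 1, 1, 1 => some 1
  | _, _, _ => none

/-- A Boolean language is weakly 0-separable if each of its relations is invariant under the
partial operations `fNand` and `gImpl`. For relations that contain the all-zero tuple this says:
the union of two disjoint tuples of `R` is in `R`, and if `s` and the disjoint union of `s` and `t`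
are in `R`, then `t` is in `R`. -/
def WeaklyZeroSeparable (Γ : Language 2) : Prop :=
  ∀ R ∈ Γ, R.Preserves fNand ∧ R.Preserves gImpl

end UDCSP

/-! A one-hot map is given by the single value that it marks. So an instance is a list of
constraints whose arguments are pairs `(v, a)`, each read as the truth value of `v = a`. A partial
assignment is a set of such pairs, and its indicator function either satisfies the constraints or
does not.

Tractable case. Let `G` be the graph of a satisfying assignment. If a subset `S` of `G` violates a
constraint, then some argument of that constraint lies in `G` but not in `S`. Hence a branching
search with at most `k` steps extends `S` to a satisfying subset of `G` (`exists_proc`). Grow `T` in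
this way from the empty set, then grow a block `S` from `T` and one further pair. Invariance under
`gImpl` makes `G` minus `S \ T` satisfying again (`Sat.diff`), so `G` splits into satisfying blocks
that pairwise share exactly `T` (`exists_blocks`). Conversely, invariance under `fNand` makes the
union of two satisfying sets with intersection `T` satisfying (`Sat.union`). Once it is guessed
which variables form which block and how the growth proceeds, the blocks can be found independently,
by trying all values of one seed variable for each block (`repSat_of_checkB`). The number of guesses
depends only on `k` and `Γ`.

Hard case. A violation of invariance, with arguments identified according to their columns in the
three tuples, yields a relation on two arguments that excludes exactly one combination: both true,
or the first true and the second false (`exists_isGadget`). The constants zero and one are simulated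
by an auxiliary variable. Either relation expresses implications `y = a → y' = a'`, the former by
excluding all other values of `y'`. Such implications encode Independent Set with `k * k` variables
that hold pairs of vertices (`repSat_indepRep`).

The machine model is handled by a calculus of polynomial-time functions (`PT`) and of functions with
computable time bounds (`CT`). -/

namespace UDCSP

/-! ## Polynomial-time functions on encoded types -/

/-- Number of nodes of a tree. -/
def Data.size : Data → ℕ
  | .nil => 1
  | .cons a b => a.size + b.size + 1

theorem Data.one_le_size (x : Data) : 1 ≤ x.size := by
  cases x <;> simp [Data.size]

/-- An encoding of a type by trees. -/
class Enc (α : Type) where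
  enc : α → Data

open Enc (enc)

/-- Size of the encoding. -/
def sz {α : Type} [Enc α] (x : α) : ℕ := (enc x).size

def encList {α : Type} (e : α → Data) : List α → Data
  | [] => .nil
  | a :: l => .cons (e a) (encList e l)

def encBool : Bool → Data
  | false => .nil
  | true => .cons .nil .nil

instance : Enc Unit := ⟨fun _ => .nil⟩
instance : Enc Bool := ⟨encBool⟩
instance : Enc ℕ := ⟨Data.ofNat⟩
instance {s : ℕ} : Enc (Fin s) := ⟨fun a => Data.ofNat a⟩
instance {α β : Type} [Enc α] [Enc β] : Enc (α × β) := ⟨fun x => .cons (enc x.1) (enc x.2)⟩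
instance {α : Type} [Enc α] : Enc (List α) := ⟨encList enc⟩

section
variable {α β γ δ : Type} [Enc α] [Enc β] [Enc γ] [Enc δ]

theorem enc_pair (a : α) (b : β) : enc (a, b) = .cons (enc a) (enc b) := rfl
theorem enc_nil : enc ([] : List α) = .nil := rfl
theorem enc_cons (a : α) (l : List α) : enc (a :: l) = .cons (enc a) (enc l) := rfl
theorem enc_false : enc false = .nil := rfl
theorem enc_true : enc true = .cons .nil .nil := rfl
theorem enc_succ (n : ℕ) : enc (n + 1) = .cons .nil (enc n) := rfl

theorem enc_input {s : ℕ} (x : List (Fin s) × ℕ) : Data.ofInput x = enc x := by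
  obtain ⟨w, k⟩ := x
  have : Data.ofString w = enc w := by
    induction w with
    | nil => rfl
    | cons a w ih => rw [enc_cons, ← ih]; rfl
  rw [enc_pair, ← this]; rfl

theorem one_le_sz (x : α) : 1 ≤ sz x := Data.one_le_size _
@[simp] theorem sz_pair (x : α × β) : sz x = sz x.1 + sz x.2 + 1 := rfl
@[simp] theorem sz_nil : sz ([] : List α) = 1 := rfl
@[simp] theorem sz_cons (a : α) (l : List α) : sz (a :: l) = sz a + sz l + 1 := rfl
@[simp] theorem sz_nat (n : ℕ) : sz n = 2 * n + 1 := by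
  induction n with
  | zero => rfl
  | succ n ih =>
    have : sz (n + 1) = 1 + sz n + 1 := rfl
    omega
theorem sz_bool (b : Bool) : sz b ≤ 3 := by cases b <;> decide
@[simp] theorem sz_unit (b : Unit) : sz b = 1 := rfl
@[simp] theorem sz_fin {s : ℕ} (n : Fin s) : sz n = 2 * n + 1 := sz_nat n

theorem sz_le_of_mem {a : α} {l : List α} (h : a ∈ l) : sz a ≤ sz l := by
  induction l with
  | nil => simp at h
  | cons b l ih =>
    rcases List.mem_cons.1 h with rfl | h
    · simp; omega
    · have := ih h; simp; omega

theorem length_lt_sz (l : List α) : l.length < sz l := by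
  induction l with
  | nil => simp
  | cons b l ih => simp; omega

theorem sz_append (l m : List α) : sz (l ++ m) + 1 = sz l + sz m := by
  induction l with
  | nil => simp; omega
  | cons b l ih => simp; omega

theorem sz_tail_le (l : List α) : sz l.tail ≤ sz l := by
  cases l <;> simp; omega

theorem sz_drop_le (i : ℕ) (l : List α) : sz (l.drop i) ≤ sz l := by
  have := sz_append (l.take i) (l.drop i)
  have := one_le_sz (l.take i)
  rw [List.take_append_drop] at *
  omega

/-! ### Polynomial bounds -/

/-- `g` is bounded by a polynomial in `s`. -/
def PB {ι : Type} (s g : ι → ℕ) : Prop := ∃ c : ℕ, ∀ x, g x ≤ (s x + 2) ^ c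

theorem PB.mono {ι : Type} {s g h : ι → ℕ} (hg : PB s g) (h' : ∀ x, h x ≤ g x) : PB s h :=
  hg.imp fun _ hc x => (h' x).trans (hc x)

theorem PB.const {ι : Type} {s : ι → ℕ} (n : ℕ) : PB s (fun _ => n) :=
  ⟨n, fun x => n.lt_two_pow_self.le.trans (Nat.pow_le_pow_left (by omega) n)⟩

theorem PB.self {ι : Type} {s : ι → ℕ} : PB s s := ⟨1, fun x => by simp⟩

theorem PB.mul {ι : Type} {s g h : ι → ℕ} (hg : PB s g) (hh : PB s h) :
    PB s (fun x => g x * h x) := by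
  obtain ⟨c, hc⟩ := hg
  obtain ⟨d, hd⟩ := hh
  exact ⟨c + d, fun x => by rw [pow_add]; exact Nat.mul_le_mul (hc x) (hd x)⟩

theorem PB.pow {ι : Type} {s g : ι → ℕ} (hg : PB s g) (n : ℕ) : PB s (fun x => g x ^ n) := by
  obtain ⟨c, hc⟩ := hg
  exact ⟨c * n, fun x => by rw [pow_mul]; exact Nat.pow_le_pow_left (hc x) n⟩

/-- The base `s x + 2` is at least two, so one more factor absorbs a sum of two powers with a common
exponent. -/
theorem PB.add {ι : Type} {s g h : ι → ℕ} (hg : PB s g) (hh : PB s h) :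
    PB s (fun x => g x + h x) := by
  obtain ⟨c, hc⟩ := hg
  obtain ⟨d, hd⟩ := hh
  refine ⟨max c d + 1, fun x => ?_⟩
  have h1 : g x ≤ (s x + 2) ^ max c d :=
    (hc x).trans (Nat.pow_le_pow_right (by omega) (le_max_left _ _))
  have h2 : h x ≤ (s x + 2) ^ max c d :=
    (hd x).trans (Nat.pow_le_pow_right (by omega) (le_max_right _ _))
  rw [pow_succ]
  nlinarith [Nat.zero_le (s x)]

theorem PB.trans {ι : Type} {s g h : ι → ℕ} (hg : PB s g) (hh : PB g h) : PB s h := by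
  obtain ⟨c, hc⟩ := hh
  exact ((hg.add (PB.const 2)).pow c).mono hc

theorem PB.comp {ι κ : Type} {s g : ι → ℕ} (h : PB s g) (f : κ → ι) :
    PB (fun x => s (f x)) (fun x => g (f x)) := h.imp fun _ hc x => hc (f x)

/-- `f` is computed by a program in polynomial time, with polynomially bounded output. -/
@[fun_prop]
def PT (f : α → β) : Prop :=
  ∃ (p : Prog) (T : α → ℕ), (∀ x, ∃ t ≤ T x, Run p (enc x) (enc (f x)) t) ∧ PB sz T ∧
    -- This does not follow from the time bound: subtrees are shared, and `cons skip skip` doubles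
    -- the size of a tree in three steps.
    PB sz (fun x => sz (f x))

theorem PT.size {f : α → β} (h : PT f) : PB sz (fun x => sz (f x)) := by
  obtain ⟨_, _, _, _, h⟩ := h; exact h

@[fun_prop]
theorem PT.id : PT (fun x : α => x) :=
  ⟨.skip, fun _ => 1, fun _ => ⟨1, le_rfl, .skip _⟩, PB.const 1, PB.self⟩

theorem exists_const_prog (d : Data) : ∃ p t, ∀ x, Run p x d t := by
  induction d with
  | nil => exact ⟨.nil, 1, .nil⟩
  | cons a b iha ihb =>
    obtain ⟨p, t, hp⟩ := iha
    obtain ⟨q, u, hq⟩ := ihb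
    exact ⟨.cons p q, _, fun x => .cons (hp x) (hq x)⟩

@[fun_prop]
theorem PT.const (b : β) : PT (fun _ : α => b) := by
  obtain ⟨p, t, hp⟩ := exists_const_prog (enc b)
  exact ⟨p, fun _ => t, fun x => ⟨t, le_rfl, hp _⟩, PB.const t, PB.const _⟩

@[fun_prop]
theorem PT.comp {g : β → γ} {f : α → β} (hg : PT g) (hf : PT f) : PT (fun x => g (f x)) := by
  obtain ⟨p, T, hp, hT, hs⟩ := hf
  obtain ⟨q, U, hq, hU, hs'⟩ := hg
  refine ⟨.seq p q, fun x => T x + U (f x) + 1, fun x => ?_, ?_, ?_⟩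
  · obtain ⟨t, ht, hr⟩ := hp x
    obtain ⟨u, hu, hr'⟩ := hq (f x)
    exact ⟨t + u + 1, by beta_reduce; omega, .seq hr hr'⟩
  · exact (hT.add (hs.trans (hU.comp f))).add (PB.const 1)
  · exact hs.trans (hs'.comp f)

@[fun_prop]
theorem PT.pair {f : α → β} {g : α → γ} (hf : PT f) (hg : PT g) : PT (fun x => (f x, g x)) := by
  obtain ⟨p, T, hp, hT, hs⟩ := hf
  obtain ⟨q, U, hq, hU, hs'⟩ := hg
  refine ⟨.cons p q, fun x => T x + U x + 1, fun x => ?_, (hT.add hU).add (PB.const 1),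
    (hs.add hs').add (PB.const 1)⟩
  obtain ⟨t, ht, hr⟩ := hp x
  obtain ⟨u, hu, hr'⟩ := hq x
  exact ⟨t + u + 1, by beta_reduce; omega, .cons hr hr'⟩

theorem PT.fst' : PT (fun x : α × β => x.1) :=
  ⟨.hd, fun _ => 1, fun _ => ⟨1, le_rfl, .hd _⟩, PB.const 1, PB.self.mono fun x => by simp; omega⟩

theorem PT.snd' : PT (fun x : α × β => x.2) :=
  ⟨.tl, fun _ => 1, fun _ => ⟨1, le_rfl, .tl _⟩, PB.const 1, PB.self.mono fun x => by simp; omega⟩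

@[fun_prop]
theorem PT.fst {f : γ → α × β} (hf : PT f) : PT (fun x => (f x).1) := PT.fst'.comp hf

@[fun_prop]
theorem PT.snd {f : γ → α × β} (hf : PT f) : PT (fun x => (f x).2) := PT.snd'.comp hf

@[fun_prop]
theorem PT.cond {c : γ → Bool} {f g : γ → α} (hc : PT c) (hf : PT f) (hg : PT g) :
    PT (fun x => bif c x then f x else g x) := by
  obtain ⟨r, W, hr, hW, -⟩ := hc
  obtain ⟨p, T, hp, hT, hs⟩ := hf
  obtain ⟨q, U, hq, hU, hs'⟩ := hg
  refine ⟨.cond r p q, fun x => W x + (T x + U x) + 1, fun x => ?_,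
    (hW.add (hT.add hU)).add (PB.const 1), (hs.add hs').mono fun x => by
      beta_reduce; cases c x <;> simp⟩
  obtain ⟨w, hw, hrw⟩ := hr x
  obtain ⟨t, ht, hrt⟩ := hp x
  obtain ⟨u, hu, hru⟩ := hq x
  cases h : c x
  · rw [h, enc_false] at hrw
    exact ⟨w + u + 1, by beta_reduce; omega, by simpa only [h] using .cond_false hrw hru⟩
  · rw [h, enc_true] at hrw
    exact ⟨w + t + 1, by beta_reduce; omega, by simpa only [h] using .cond_true hrw hrt⟩

/-- A program that computes a function on encodings, for another type with the same encoding. -/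
theorem PT.of_enc_eq {f : α → β} (h : ∀ x, enc (f x) = enc x) : PT f :=
  ⟨.skip, fun _ => 1, fun x => ⟨1, le_rfl, by rw [h]; exact .skip _⟩, PB.const 1,
    PB.self.mono fun x => by rw [sz, sz, h]⟩

/-! ### Folds -/

/-- The program that folds: `init` produces the accumulator, `lst` the list, and `step` maps a
triple of context, accumulator and list element to the new accumulator. -/
def foldProg (lst init step : Prog) : Prog :=
  .seq (.seq (.cons .skip (.cons init lst))
    (.loop (.seq .tl .tl)
      (.cons .hd
        (.cons (.seq (.cons .hd (.cons (.seq .tl .hd) (.seq (.seq .tl .tl) .hd))) step)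
          (.seq (.seq .tl .tl) .tl)))))
    (.seq .tl .hd)

/-- The step bound `T` is needed only for accumulators that occur in this run. The constant 30 pays
for rearranging the state in each round. -/
theorem foldProg_run {lst init step : Prog} {x : γ} {l : List α} {b : β} {f : β → α → β}
    {t u : ℕ} (T : ℕ) (hl : Run lst (enc x) (enc l) t) (hi : Run init (enc x) (enc b) u)
    (hs : ∀ l₁ a l₂, l = l₁ ++ a :: l₂ → ∃ v ≤ T, Run step (enc (x, l₁.foldl f b, a))
      (enc (f (l₁.foldl f b) a)) v) :
    ∃ v ≤ t + u + (l.length + 1) * (T + 30) , Run (foldProg lst init step) (enc x)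
      (enc (l.foldl f b)) v := by
  -- Loop invariant: the state is the context, the fold of the processed prefix `l₁`, and the
  -- remaining list `l₂`.
  have key : ∀ l₂ l₁, l = l₁ ++ l₂ → ∃ v ≤ l₂.length * (T + 30) + 4,
      Run (.loop (.seq .tl .tl)
      (.cons .hd
        (.cons (.seq (.cons .hd (.cons (.seq .tl .hd) (.seq (.seq .tl .tl) .hd))) step)
          (.seq (.seq .tl .tl) .tl)))) (enc (x, l₁.foldl f b, l₂))
        (enc (x, l.foldl f b, ([] : List α))) v := by
    intro l₂
    induction l₂ with
    | nil =>
      intro l₁ h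
      obtain rfl : l = l₁ := by simpa using h
      exact ⟨_, by simp, .loop_done (t := 3) (.seq (t := 1) (u := 1) (.tl _) (.tl _))⟩
    | cons a l₂ ih =>
      intro l₁ h
      obtain ⟨v, hv, hr⟩ := hs l₁ a l₂ h
      obtain ⟨w, hw, hr'⟩ := ih (l₁ ++ [a]) (by simpa using h)
      rw [List.foldl_append, List.foldl_cons, List.foldl_nil] at hr'
      refine ⟨3 + (1 + ((1 + (3 + 5 + 1) + 1) + v + 1 + 5 + 1) + 1) + w + 1, ?_,
        .loop_step (.seq (.tl _) (.tl _))
          (.cons (.hd _) (.cons (.seq (.cons (.hd _) (.cons (.seq (.tl _) (.hd _))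
            (.seq (.seq (.tl _) (.tl _)) (.hd _)))) hr) (.seq (.seq (.tl _) (.tl _)) (.tl _)))) hr'⟩
      simp only [List.length_cons, add_mul, one_mul] at *
      omega
  obtain ⟨v, hv, hr⟩ := key l [] rfl
  refine ⟨_, ?_, .seq (.seq (.cons (.skip _) (.cons hi hl)) hr) (.seq (.tl _) (.hd _))⟩
  rw [add_mul]
  omega

/-- Folds are polynomial-time if the accumulator grows by a polynomial amount per step. -/
theorem PT.foldl {l : γ → List α} {b : γ → β} {f : γ → β → α → β} (hl : PT l) (hb : PT b)
    (hf : PT (fun p : γ × β × α => f p.1 p.2.1 p.2.2)) (D : γ → ℕ) (hD : PB sz D)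
    (hs : ∀ x y a, a ∈ l x → sz (f x y a) ≤ sz y + D x) :
    PT (fun x => (l x).foldl (f x) (b x)) := by
  obtain ⟨p, T, hp, hT, hps⟩ := hl
  obtain ⟨q, U, hq, hU, hqs⟩ := hb
  obtain ⟨r, W, hr, ⟨c, hW⟩, -⟩ := hf
  -- The growth `D x` per step does not depend on the accumulator, so sizes grow linearly with the
  -- number of steps and are not compounded.
  have hacc : ∀ x (l₁ : List α), (∀ a ∈ l₁, a ∈ l x) →
      sz (l₁.foldl (f x) (b x)) ≤ sz (b x) + l₁.length * D x := by
    intro x l₁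
    induction l₁ using List.reverseRecOn with
    | nil => simp
    | append_singleton l₁ a ih =>
      intro h
      have h1 := ih fun a ha => h a (by simp [ha])
      have h2 := hs x (l₁.foldl (f x) (b x)) a (h a (by simp))
      simp only [List.foldl_append, List.foldl_cons, List.foldl_nil, List.length_append,
        List.length_cons, List.length_nil, add_mul, zero_add, one_mul]
      omega
  let M : γ → ℕ := fun x => sz (b x) + sz (l x) * D x
  have hM : PB sz M := hqs.add (hps.mul hD)
  have hM' : ∀ x l₁ l₂, l x = l₁ ++ l₂ → sz (l₁.foldl (f x) (b x)) ≤ M x := by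
    intro x l₁ l₂ h
    refine (hacc x l₁ (by rw [h]; simp +contextual)).trans ?_
    have := length_lt_sz (l x)
    have h3 : l₁.length ≤ (l x).length := by simp [h]
    exact Nat.add_le_add_left (Nat.mul_le_mul_right _ (by omega)) _
  let V : γ → ℕ := fun x => (sz x + (M x + sz (l x) + 1) + 1 + 2) ^ c
  have hV : PB sz V :=
    (((PB.self.add ((hM.add hps).add (PB.const 1))).add (PB.const 1)).add (PB.const 2)).pow c
  refine ⟨foldProg p q r, fun x => T x + U x + sz (l x) * (V x + 30), fun x => ?_,
    (hT.add hU).add (hps.mul (hV.add (PB.const 30))), hM.mono fun x => ?_⟩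
  · obtain ⟨t, ht, hrt⟩ := hp x
    obtain ⟨u, hu, hru⟩ := hq x
    obtain ⟨v, hv, hrv⟩ := foldProg_run (f := f x) (step := r) (V x) hrt hru (by
      intro l₁ a l₂ h
      obtain ⟨w, hw, hrw⟩ := hr (x, l₁.foldl (f x) (b x), a)
      refine ⟨w, hw.trans ((hW _).trans (Nat.pow_le_pow_left ?_ c)), hrw⟩
      have h1 := hM' x l₁ _ h
      have h2 : sz a ≤ sz (l x) := sz_le_of_mem (by simp [h])
      simp only [sz_pair]
      omega)
    refine ⟨v, hv.trans ?_, hrv⟩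
    have := Nat.mul_le_mul_right (V x + 30) (length_lt_sz (l x))
    rw [Nat.succ_eq_add_one] at this
    beta_reduce
    omega
  · exact hM' x _ [] (by simp)

end

/-! ### A library of polynomial-time functions -/

section
variable {α β γ δ : Type} [Enc α] [Enc β] [Enc γ] [Enc δ]

@[fun_prop]
theorem PT.cons {f : γ → α} {g : γ → List α} (hf : PT f) (hg : PT g) :
    PT (fun x => f x :: g x) := by
  obtain ⟨p, T, hp, hT, hs⟩ := hf.pair hg
  exact ⟨p, T, hp, hT, hs⟩

theorem PT.tail' : PT (fun l : List α => l.tail) :=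
  ⟨.tl, fun _ => 1, fun l => ⟨1, le_rfl, by cases l <;> exact .tl _⟩, PB.const 1,
    PB.self.mono sz_tail_le⟩

@[fun_prop]
theorem PT.tail {l : γ → List α} (hl : PT l) : PT (fun x => (l x).tail) := PT.tail'.comp hl

/-- Whether a list is nonempty. -/
def isNE (l : List α) : Bool := !l.isEmpty

omit [Enc α] in
@[simp] theorem isNE_eq (l : List α) : isNE l = true ↔ l ≠ [] := by
  cases l <;> simp [isNE]

theorem PT.neNil' : PT (fun l : List α => isNE l) := by
  refine ⟨.cond .skip (.cons .nil .nil) .nil, fun _ => 5, fun l => ?_, PB.const 5,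
    (PB.const 3).mono fun _ => sz_bool _⟩
  cases l with
  | nil => exact ⟨_, by simp, .cond_false (.skip _) (.nil _)⟩
  | cons a l => exact ⟨_, by simp, .cond_true (.skip _) (.cons (.nil _) (.nil _))⟩

@[fun_prop]
theorem PT.neNil {l : γ → List α} (hl : PT l) : PT (fun x => isNE (l x)) :=
  PT.neNil'.comp hl

@[fun_prop]
theorem PT.headD {l : γ → List α} {d : γ → α} (hl : PT l) (hd : PT d) :
    PT (fun x => (l x).headD (d x)) := by
  have h : PT (fun p : List α × α => p.1.headD p.2) := by
    refine ⟨.cond .hd (.seq .hd .hd) .tl, fun _ => 5, fun ⟨l, d⟩ => ?_, PB.const 5,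
      PB.self.mono fun ⟨l, d⟩ => ?_⟩
    · cases l with
      | nil => exact ⟨_, by simp, .cond_false (.hd _) (.tl _)⟩
      | cons a l => exact ⟨_, by simp, .cond_true (.hd _) (.seq (.hd _) (.hd _))⟩
    · cases l <;> simp only [List.headD_nil, List.headD_cons, sz_pair, sz_cons, sz_nil] <;> omega
  exact h.comp (hl.pair hd)

@[fun_prop]
theorem PT.succ {f : γ → ℕ} (hf : PT f) : PT (fun x => f x + 1) := by
  have h : PT (fun n : ℕ => n + 1) :=
    ⟨.cons .nil .skip, fun _ => 3, fun n => ⟨3, le_rfl, .cons (.nil _) (.skip _)⟩, PB.const 3,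
      (PB.self.add (PB.const 2)).mono fun n => by simp; omega⟩
  exact h.comp hf

@[fun_prop]
theorem PT.pred {f : γ → ℕ} (hf : PT f) : PT (fun x => f x - 1) := by
  have h : PT (fun n : ℕ => n - 1) :=
    ⟨.tl, fun _ => 1, fun n => ⟨1, le_rfl, by cases n <;> exact .tl _⟩, PB.const 1,
      PB.self.mono fun n => by simp⟩
  exact h.comp hf

/-- Converting a number to a list of units costs nothing, so bounded iteration becomes a fold. -/
theorem enc_replicate_unit (n : ℕ) : enc (List.replicate n ()) = enc n := by
  induction n with
  | zero => rfl
  | succ n ih => rw [List.replicate_succ, enc_cons, ih]; rfl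

@[fun_prop]
theorem PT.units {f : γ → ℕ} (hf : PT f) : PT (fun x => List.replicate (f x) ()) :=
  PT.comp (g := fun n => List.replicate n ()) (PT.of_enc_eq enc_replicate_unit) hf

omit [Enc β] in
theorem foldl_units (f : β → β) (n : ℕ) (b : β) :
    (List.replicate n ()).foldl (fun b _ => f b) b = f^[n] b := by
  induction n generalizing b with
  | zero => rfl
  | succ n ih => rw [List.replicate_succ, List.foldl_cons, ih, Function.iterate_succ_apply]

theorem PT.iterate {n : γ → ℕ} {b : γ → β} {f : γ → β → β} (hn : PT n) (hb : PT b)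
    (hf : PT (fun p : γ × β => f p.1 p.2)) (D : γ → ℕ) (hD : PB sz D)
    (hs : ∀ x y, sz (f x y) ≤ sz y + D x) :
    PT (fun x => (f x)^[n x] (b x)) := by
  simp only [← foldl_units]
  refine PT.foldl (f := fun x b _ => f x b) (by fun_prop) hb ?_ D hD fun x y _ _ => hs x y
  exact PT.comp (g := fun p : γ × β => f p.1 p.2) hf
    (f := fun p : γ × β × Unit => (p.1, p.2.1)) (by fun_prop)

@[fun_prop]
theorem PT.add {f g : γ → ℕ} (hf : PT f) (hg : PT g) : PT (fun x => f x + g x) := by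
  have : PT (fun x => (fun b : ℕ => b + 1)^[g x] (f x)) :=
    PT.iterate (f := fun _ b => b + 1) hg hf (by fun_prop) (fun _ => 2) (PB.const 2)
      fun x y => by simp; omega
  simpa [Nat.succ_iterate] using this

@[fun_prop]
theorem PT.sub {f g : γ → ℕ} (hf : PT f) (hg : PT g) : PT (fun x => f x - g x) := by
  have : PT (fun x => (fun b : ℕ => b - 1)^[g x] (f x)) :=
    PT.iterate (f := fun _ b => b - 1) hg hf (by fun_prop) (fun _ => 0) (PB.const 0)
      fun x y => by simp
  simpa only [← Nat.pred_eq_sub_one, Nat.pred_iterate] using this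

@[fun_prop]
theorem PT.mul {f g : γ → ℕ} (hf : PT f) (hg : PT g) : PT (fun x => f x * g x) := by
  have : PT (fun x => (fun b : ℕ => b + f x)^[g x] 0) :=
    PT.iterate (f := fun x b => b + f x) hg (PT.const 0) (by fun_prop) (fun x => sz (f x)) hf.size
      fun x y => by simp; omega
  simpa [Function.iterate_add_apply, mul_comm] using this

@[fun_prop]
theorem PT.not {f : γ → Bool} (hf : PT f) : PT (fun x => !f x) := by
  have : PT (fun x => bif f x then false else true) := by fun_prop
  exact this

@[fun_prop]
theorem PT.and {f g : γ → Bool} (hf : PT f) (hg : PT g) : PT (fun x => f x && g x) := by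
  have : PT (fun x => bif f x then g x else false) := by fun_prop
  convert this using 2 with x
  cases f x <;> rfl

@[fun_prop]
theorem PT.or {f g : γ → Bool} (hf : PT f) (hg : PT g) : PT (fun x => f x || g x) := by
  have : PT (fun x => bif f x then true else g x) := by fun_prop
  exact this

@[fun_prop]
theorem PT.le {f g : γ → ℕ} (hf : PT f) (hg : PT g) : PT (fun x => decide (f x ≤ g x)) := by
  have h : PT (fun x => !isNE (List.replicate (f x - g x) ())) := by fun_prop
  convert h using 2 with x
  rw [Bool.eq_iff_iff]
  simp [isNE, Nat.sub_eq_zero_iff_le]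

@[fun_prop]
theorem PT.lt {f g : γ → ℕ} (hf : PT f) (hg : PT g) : PT (fun x => decide (f x < g x)) :=
  PT.le hf.succ hg

/-- Types on which equality of encodings is decidable in polynomial time. -/
class DecPT (α : Type) [Enc α] [DecidableEq α] : Prop where
  dec : PT (fun p : α × α => decide (p.1 = p.2))

@[fun_prop]
theorem PT.eq [DecidableEq α] [DecPT α] {f g : γ → α} (hf : PT f) (hg : PT g) :
    PT (fun x => decide (f x = g x)) :=
  PT.comp (g := fun p : α × α => decide (p.1 = p.2)) DecPT.dec (hf.pair hg)

instance : DecPT ℕ := ⟨by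
  have : PT (fun p : ℕ × ℕ => decide (p.1 ≤ p.2) && decide (p.2 ≤ p.1)) := by fun_prop
  convert this using 2 with p
  simp [le_antisymm_iff]⟩

instance : DecPT Bool := ⟨by
  have : PT (fun p : Bool × Bool => bif p.1 then p.2 else !p.2) := by fun_prop
  convert this using 2 with p
  rcases p with ⟨_ | _, _ | _⟩ <;> rfl⟩

@[fun_prop]
theorem PT.finVal {s : ℕ} {f : γ → Fin s} (hf : PT f) : PT (fun x => (f x : ℕ)) :=
  PT.comp (g := fun a : Fin s => (a : ℕ)) (PT.of_enc_eq fun _ => rfl) hf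

instance {s : ℕ} : DecPT (Fin s) := ⟨by
  simp only [Fin.ext_iff]
  fun_prop⟩

instance [DecidableEq α] [DecidableEq β] [DecPT α] [DecPT β] : DecPT (α × β) := ⟨by
  have : PT (fun p : (α × β) × α × β => decide (p.1.1 = p.2.1) && decide (p.1.2 = p.2.2)) := by
    fun_prop
  convert this using 2 with p
  simp [Prod.ext_iff]⟩

@[fun_prop]
theorem PT.reverse {l : γ → List α} (hl : PT l) : PT (fun x => (l x).reverse) := by
  have : PT (fun x => (l x).foldl (fun b a => a :: b) []) :=
    PT.foldl (f := fun _ b a => a :: b) hl (PT.const []) (by fun_prop) (fun x => sz (l x) + 1)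
      (hl.size.add (PB.const 1)) fun x y a ha => by have := sz_le_of_mem ha; simp; omega
  simpa using this

@[fun_prop]
theorem PT.append {l m : γ → List α} (hl : PT l) (hm : PT m) : PT (fun x => l x ++ m x) := by
  have : PT (fun x => (l x).reverse.foldl (fun b a => a :: b) (m x)) :=
    PT.foldl (f := fun _ b a => a :: b) hl.reverse hm (by fun_prop) (fun x => sz (l x) + 1)
      (hl.size.add (PB.const 1)) fun x y a ha => by
        have := sz_le_of_mem (List.mem_reverse.1 ha); simp; omega
  simpa using this

@[fun_prop]
theorem PT.map {l : γ → List α} {f : γ → α → β} (hf : PT (fun p : γ × α => f p.1 p.2))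
    (hl : PT l) : PT (fun x => (l x).map (f x)) := by
  have : PT (fun x => ((l x).foldl (fun b a => f x a :: b) []).reverse) := by
    refine PT.reverse ?_
    obtain ⟨c, hc⟩ := hf.size
    refine PT.foldl (f := fun x b a => f x a :: b) hl (PT.const []) ?_
      (fun x => (sz x + sz (l x) + 1 + 2) ^ c + 1)
      (((((PB.self.add hl.size).add (PB.const 1)).add (PB.const 2)).pow c).add (PB.const 1))
      fun x y a ha => ?_
    · have : PT (fun p : γ × List β × α => f p.1 p.2.2) :=
        PT.comp (g := fun p : γ × α => f p.1 p.2) hf (f := fun p : γ × List β × α => (p.1, p.2.2))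
        (by fun_prop)
      fun_prop
    · have h1 := sz_le_of_mem ha
      have h2 : sz (f x a) ≤ (sz x + sz (l x) + 1 + 2) ^ c :=
        (hc (x, a)).trans (Nat.pow_le_pow_left (by simp; omega) c)
      simp only [sz_cons]
      omega
  convert this using 2 with x
  simp

@[fun_prop]
theorem PT.flatten {l : γ → List (List α)} (hl : PT l) : PT (fun x => (l x).flatten) := by
  have : PT (fun x => (l x).foldl (fun b a => b ++ a) []) :=
    PT.foldl (f := fun _ b a => b ++ a) hl (PT.const []) (by fun_prop) (fun x => sz (l x))
      hl.size fun x y a ha => by have := sz_le_of_mem ha; have := sz_append y a; omega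
  convert this using 2 with x
  suffices h : ∀ (l' : List (List α)) b, l'.foldl (fun b a => b ++ a) b = b ++ l'.flatten by
    simpa using (h (l x) []).symm
  intro l'
  induction l' with
  | nil => simp
  | cons a l' ih => intro b; simp [ih]

@[fun_prop]
theorem PT.flatMap {l : γ → List α} {f : γ → α → List β} (hf : PT (fun p : γ × α => f p.1 p.2))
    (hl : PT l) : PT (fun x => (l x).flatMap (f x)) := by
  simp only [List.flatMap_def]
  fun_prop

@[fun_prop]
theorem PT.filter {l : γ → List α} {f : γ → α → Bool} (hf : PT (fun p : γ × α => f p.1 p.2))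
    (hl : PT l) : PT (fun x => (l x).filter (f x)) := by
  have : PT (fun x => (l x).flatMap fun a => bif f x a then [a] else []) := by fun_prop
  convert this using 2 with x
  induction l x with
  | nil => rfl
  | cons a l ih => rw [List.filter_cons, List.flatMap_cons, ← ih]; cases f x a <;> rfl

@[fun_prop]
theorem PT.any {l : γ → List α} {f : γ → α → Bool} (hf : PT (fun p : γ × α => f p.1 p.2))
    (hl : PT l) : PT (fun x => (l x).any (f x)) := by
  have : PT (fun x => isNE ((l x).filter (f x))) := by fun_prop
  convert this using 2 with x
  rw [Bool.eq_iff_iff]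
  simp

@[fun_prop]
theorem PT.all {l : γ → List α} {f : γ → α → Bool} (hf : PT (fun p : γ × α => f p.1 p.2))
    (hl : PT l) : PT (fun x => (l x).all (f x)) := by
  have : PT (fun x => !(l x).any fun a => !f x a) := by fun_prop
  convert this using 2 with x
  rw [Bool.eq_iff_iff]
  simp

@[fun_prop]
theorem PT.length {l : γ → List α} (hl : PT l) : PT (fun x => (l x).length) := by
  have : PT (fun x => (l x).foldl (fun b _ => b + 1) 0) :=
    PT.foldl (f := fun _ b _ => b + 1) hl (PT.const 0) (by fun_prop) (fun _ => 2) (PB.const 2)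
      fun x y a ha => by simp; omega
  simpa using this

@[fun_prop]
theorem PT.drop {n : γ → ℕ} {l : γ → List α} (hn : PT n) (hl : PT l) :
    PT (fun x => (l x).drop (n x)) := by
  have : PT (fun x => (fun b : List α => b.tail)^[n x] (l x)) :=
    PT.iterate (f := fun _ b => b.tail) hn hl (by fun_prop) (fun x => 0) (PB.const 0)
      fun x y => sz_tail_le _
  convert this using 2 with x
  generalize l x = l'
  induction n x generalizing l' with
  | zero => rfl
  | succ n ih => rw [Function.iterate_succ_apply, ← ih, List.drop_tail]

@[fun_prop]
theorem PT.getD {n : γ → ℕ} {l : γ → List α} {d : γ → α} (hl : PT l) (hn : PT n) (hd : PT d) :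
    PT (fun x => (l x).getD (n x) (d x)) := by
  have : PT (fun x => ((l x).drop (n x)).headD (d x)) := by fun_prop
  convert this using 2 with x
  simp

@[fun_prop]
theorem PT.range {n : γ → ℕ} (hn : PT n) : PT (fun x => List.range (n x)) := by
  have : PT (fun x => (fun b : List ℕ => (n x - 1 - b.length) :: b)^[n x] []) :=
    PT.iterate (f := fun x b => (n x - 1 - b.length) :: b) hn (PT.const []) (by fun_prop)
      (fun x => sz (n x) + 1) (hn.size.add (PB.const 1)) fun x y => by simp; omega
  convert this using 2 with x
  generalize n x = m
  -- The list is built from its last element backwards; its current length determines the next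
  -- entry.
  suffices h : ∀ i ≤ m, (fun b : List ℕ => (m - 1 - b.length) :: b)^[i] [] =
      List.range' (m - i) i by rw [h m le_rfl, List.range_eq_range', Nat.sub_self]
  intro i
  induction i with
  | zero => simp
  | succ i ih =>
    intro hi
    rw [Function.iterate_succ_apply', ih (by omega), List.range'_succ, List.length_range']
    congr 1
    · omega
    · congr 1
      omega

instance [DecidableEq α] [Inhabited α] [DecPT α] : DecPT (List α) := ⟨by
  have : PT (fun p : List α × List α => decide (p.1.length = p.2.length) &&
      (List.range p.1.length).all fun i => decide (p.1.getD i default = p.2.getD i default)) := by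
    fun_prop
  convert this using 2 with p
  rw [Bool.eq_iff_iff]
  simp only [decide_eq_true_eq, Bool.and_eq_true, List.all_eq_true, List.mem_range]
  constructor
  · rintro h
    simp [h]
  · rintro ⟨h, h'⟩
    refine List.ext_getElem h fun i h1 h2 => ?_
    simpa [h1, h2] using h' i h1⟩

@[fun_prop]
theorem PT.mem [DecidableEq α] [DecPT α] {a : γ → α} {l : γ → List α}
    [∀ x, Decidable (a x ∈ l x)] (ha : PT a) (hl : PT l) : PT (fun x => decide (a x ∈ l x)) := by
  have : PT (fun x => (l x).any fun b => decide (a x = b)) := by fun_prop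
  convert this using 2 with x
  rw [Bool.eq_iff_iff]
  simp

end

/-! ### Unary codes -/

section
variable {γ : Type} [Enc γ]

@[fun_prop]
theorem pt_unaryCode {l : γ → List ℕ} (hl : PT l) : PT (fun x => unaryCode (l x)) := by
  have : PT (fun x => (l x).flatMap fun a =>
      (List.replicate a ()).map (fun _ => (1 : Fin 2)) ++ [0]) := by fun_prop
  convert this using 2 with x
  simp [unaryCode]

/-- Inverse of `unaryCode`. -/
def decodeNums (w : List (Fin 2)) : List ℕ :=
  (w.foldl (fun s a => bif decide (a = 1) then (s.1 + 1, s.2) else (0, s.1 :: s.2))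
    ((0, []) : ℕ × List ℕ)).2.reverse

@[fun_prop]
theorem pt_decodeNums {w : γ → List (Fin 2)} (hw : PT w) : PT (fun x => decodeNums (w x)) := by
  refine PT.reverse (PT.snd ?_)
  refine PT.foldl (f := fun _ s a => bif decide (a = 1) then (s.1 + 1, s.2) else (0, s.1 :: s.2))
    hw (PT.const _) (by fun_prop) (fun _ => 2) (PB.const 2) fun x s a _ => ?_
  cases decide (a = 1) <;> simp <;> omega

theorem decodeNums_unaryCode (l : List ℕ) : decodeNums (unaryCode l) = l := by
  -- The state holds the number of ones read since the last zero, and the finished numbers in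
  -- reverse order.
  have h1 : ∀ (a c : ℕ) (s : List ℕ), (List.replicate a (1 : Fin 2)).foldl
      (fun s a => bif decide (a = 1) then (s.1 + 1, s.2) else (0, s.1 :: s.2)) (c, s) =
      (c + a, s) := by
    intro a
    induction a with
    | zero => intros; rfl
    | succ a ih => intro c s; rw [List.replicate_succ, List.foldl_cons]; simp [ih]; omega
  have h2 : ∀ (l s : List ℕ), (unaryCode l).foldl
      (fun s a => bif decide (a = 1) then (s.1 + 1, s.2) else (0, s.1 :: s.2)) (0, s) =
      (0, l.reverse ++ s) := by
    intro l
    induction l with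
    | nil => intros; rfl
    | cons a l ih =>
      intro s
      have : unaryCode (a :: l) = List.replicate a 1 ++ (0 :: unaryCode l) := by simp [unaryCode]
      rw [this, List.foldl_append, h1]
      simp [ih]
  simp [decodeNums, h2]

/-- The nonempty lists among the iterates of `step` on `l`. -/
def rests (step : List ℕ → List ℕ) (l : List ℕ) : List (List ℕ) :=
  ((List.range l.length).map fun i => step^[i] l).filter isNE

theorem pt_rests {step : γ → List ℕ → List ℕ} {l : γ → List ℕ}
    (hstep : PT (fun p : γ × List ℕ => step p.1 p.2)) (hl : PT l)
    (hs : ∀ x y, sz (step x y) ≤ sz y) : PT (fun x => rests (step x) (l x)) := by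
  refine PT.filter (f := fun _ => isNE) (by fun_prop) (PT.map ?_ (by fun_prop))
  exact PT.iterate (f := fun (p : γ × ℕ) b => step p.1 b) (by fun_prop) (by fun_prop)
    (PT.comp (g := fun p : γ × List ℕ => step p.1 p.2) hstep
      (f := fun p : (γ × ℕ) × List ℕ => (p.1.1, p.2)) (by fun_prop))
    (fun _ => 0) (PB.const 0) fun x y => hs _ _

/-- Correctness of parsing for any self-delimiting code. The iterates of `step` are the suffixes
that start at an item, followed by empty lists, which `rests` discards. Since every code word is
nonempty, the length of the list is a sufficient number of iterations. -/
theorem map_rests_flatMap {ι : Type} (step : List ℕ → List ℕ) (parse : List ℕ → ι)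
    (e : ι → List ℕ) (items : List ι) (h0 : step [] = [])
    (he : ∀ i ∈ items, ∀ l, e i ≠ [] ∧ step (e i ++ l) = l ∧ parse (e i ++ l) = i) :
    (rests step (items.flatMap e)).map parse = items := by
  have h : ∀ (items : List ι) (m : ℕ), items.length ≤ m →
      (∀ i ∈ items, ∀ l, e i ≠ [] ∧ step (e i ++ l) = l ∧ parse (e i ++ l) = i) →
      ((((List.range m).map fun i => step^[i] (items.flatMap e)).filter isNE).map parse) =
        items := by
    intro items
    induction items with
    | nil =>
      intro m _ _
      have : ∀ i, step^[i] [] = [] := fun i => Function.iterate_fixed h0 i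
      simp [this]
    | cons i items ih =>
      intro m hm he
      obtain ⟨m, rfl⟩ : ∃ m', m = m' + 1 := ⟨m - 1, by simp at hm; omega⟩
      obtain ⟨h1, h2, h3⟩ := he i (by simp) (items.flatMap e)
      rw [List.range_succ_eq_map, List.map_cons, List.filter_cons_of_pos (by simp [h1]),
        List.map_cons, List.map_map]
      simp only [Function.iterate_zero, id, List.flatMap_cons, h3, Function.comp_def,
        Function.iterate_succ_apply, h2]
      rw [ih m (by simpa using hm) fun j hj => he j (by simp [hj])]
  refine h items _ ?_ he
  clear h
  induction items with
  | nil => simp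
  | cons i items ih =>
    have := ih fun j hj => he j (by simp [hj])
    have h1 := List.length_pos_iff.2 (he i (by simp) []).1
    simp only [List.flatMap_cons, List.length_append, List.length_cons]
    omega

/-! ### Instances as lists of numbers -/

/-- A constraint: the position of its relation, and its arguments, where `(v, a)` stands for the
map of the variable `v` that is one at `a`. -/
abbrev Con : Type := ℕ × List (ℕ × ℕ)

/-- Domain size, number of variables, constraints. -/
abbrev Rep : Type := ℕ × ℕ × List Con

/-- The numbers that encode a constraint. -/
def conNums (n : ℕ) (c : Con) : List ℕ :=
  c.1 :: c.2.flatMap fun p => p.1 :: (List.range n).map fun b => bif decide (b = p.2) then 1 else 0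

/-- The encoding of an instance. -/
def encRep (r : Rep) : List (Fin 2) :=
  unaryCode (r.1 :: r.2.1 :: r.2.2.flatMap (conNums r.1))

@[fun_prop]
theorem pt_encRep {r : γ → Rep} (hr : PT r) : PT (fun x => encRep (r x)) := by
  unfold encRep conNums
  fun_prop

/-- Removes the first constraint. -/
def conStep (ar : List ℕ) (n : ℕ) (l : List ℕ) : List ℕ :=
  -- One number for the relation; then each argument takes one number for the variable and `n` for
  -- the value table.
  l.drop (1 + ar.getD (l.headD 0) 0 * (n + 1))

/-- Reads the first constraint. -/
def conParse (ar : List ℕ) (n : ℕ) (l : List ℕ) : Con :=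
  (l.headD 0, (List.range (ar.getD (l.headD 0) 0)).map fun i =>
    (l.getD (1 + i * (n + 1)) 0,
      ((List.range n).filter fun j => decide (l.getD (1 + i * (n + 1) + (j + 1)) 0 = 1)).headD 0))

/-- Inverse of `encRep`. -/
def decRep (ar : List ℕ) (w : List (Fin 2)) : Rep :=
  let l := decodeNums w
  (l.headD 0, l.getD 1 0,
    (rests (conStep ar (l.headD 0)) (l.drop 2)).map (conParse ar (l.headD 0)))

@[fun_prop]
theorem pt_decRep (ar : List ℕ) {w : γ → List (Fin 2)} (hw : PT w) :
    PT (fun x => decRep ar (w x)) := by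
  have h : PT (fun x => rests (conStep ar ((decodeNums (w x)).headD 0))
      ((decodeNums (w x)).drop 2)) :=
    pt_rests (step := fun x l => conStep ar ((decodeNums (w x)).headD 0) l)
      (by unfold conStep; fun_prop) (by fun_prop) fun x y => sz_drop_le _ _
  unfold decRep conParse
  dsimp only
  fun_prop

/-- The constraints have the right arities `ar`, and arguments in range. -/
def ValidRep (ar : List ℕ) (r : Rep) : Prop :=
  ∀ c ∈ r.2.2, c.1 < ar.length ∧ c.2.length = ar.getD c.1 0 ∧ ∀ p ∈ c.2, p.1 < r.2.1 ∧ p.2 < r.1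

theorem length_argNums (n : ℕ) (l : List (ℕ × ℕ)) :
    (l.flatMap fun p => p.1 :: (List.range n).map fun b => bif decide (b = p.2) then 1 else 0).length
      = l.length * (n + 1) := by
  induction l with
  | nil => simp
  | cons p l ih => simp [ih]; ring

theorem getElem?_argNums (n : ℕ) (l : List (ℕ × ℕ)) (m : List ℕ) (i j : ℕ) (hi : i < l.length)
    (hj : j < n + 1) :
    ((l.flatMap fun p => p.1 :: (List.range n).map fun b => bif decide (b = p.2) then 1 else 0)
      ++ m)[i * (n + 1) + j]? =
      (l[i].1 :: (List.range n).map fun b => bif decide (b = l[i].2) then 1 else 0)[j]? := by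
  induction l generalizing i with
  | nil => simp at hi
  | cons p l ih =>
    rw [List.flatMap_cons, List.append_assoc]
    cases i with
    | zero => rw [zero_mul, zero_add, List.getElem?_append_left (by simpa using hj)]; rfl
    | succ i =>
      rw [List.getElem?_append_right (by simp; nlinarith)]
      refine Eq.trans ?_ (ih i (by simpa using hi))
      congr 1
      simp [add_mul]
      omega

/-- Validity enters twice: the arity tells where a constraint ends, and a marked value below `n` can
be recovered from its table. -/
theorem decRep_encRep {ar : List ℕ} {r : Rep} (h : ValidRep ar r) : decRep ar (encRep r) = r := by
  obtain ⟨n, k, cs⟩ := r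
  simp only [decRep, encRep, decodeNums_unaryCode, List.headD_cons, List.getD_cons_succ,
    List.getD_cons_zero, List.drop_succ_cons, List.drop_zero, Prod.mk.injEq, true_and]
  refine map_rests_flatMap _ _ _ _ (by simp [conStep]) fun c hc m => ?_
  obtain ⟨ρ, l⟩ := c
  obtain ⟨h1, h2, h3⟩ := h _ hc
  simp only at h1 h2 h3
  refine ⟨by simp [conNums], ?_, ?_⟩
  · simp only [conStep, conNums, List.cons_append, List.headD_cons, add_comm 1,
      List.drop_succ_cons]
    rw [List.drop_append_of_le_length (by rw [length_argNums, h2]), List.drop_of_length_le,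
      List.nil_append]
    rw [length_argNums, h2]
  · simp only [conParse, conNums, List.cons_append, List.headD_cons, ← h2, Prod.mk.injEq, true_and]
    refine List.ext_getElem (by simp) fun i hi hi' => ?_
    have key := getElem?_argNums n l m i
    rw [List.getElem_map, List.getElem_range, List.getD_eq_getElem?_getD, add_comm 1,
      List.getElem?_cons_succ]
    refine Prod.ext ?_ ?_
    · have := key 0 hi' (by omega)
      simp only [add_zero] at this
      simp [this]
    · have hlt := (h3 _ (List.getElem_mem hi')).2
      -- The table of a one-hot map contains a single one, at the marked value.
      have : ((List.range n).filter fun j => decide ((ρ :: ((l.flatMap fun p => p.1 ::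
          (List.range n).map fun b => bif decide (b = p.2) then 1 else 0) ++ m)).getD
            (i * (n + 1) + 1 + (j + 1)) 0 = 1)) = [l[i].2] := by
        rw [List.filter_congr (q := fun j => j == l[i].2)]
        · rw [List.filter_beq, List.count_eq_one_of_mem List.nodup_range (by simpa using hlt)]
          rfl
        · intro j hj
          have hj' : j < n := by simpa using hj
          rw [show i * (n + 1) + 1 + (j + 1) = (i * (n + 1) + (j + 1)) + 1 by omega,
            List.getD_cons_succ, List.getD_eq_getElem?_getD, key (j + 1) hi' (by omega)]
          rw [Bool.eq_iff_iff]
          by_cases hjj : j = l[i].2 <;> simp [hj', hjj, hlt]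
      exact (congrArg (List.headD · 0) this).trans rfl

end

/-! ### One-Hot-CSP in terms of lists -/

/-- A Boolean tuple as a list. -/
def tupBits {r : ℕ} (t : Fin r → Fin 2) : List Bool := List.ofFn fun i => decide (t i = 1)

theorem tupBits_injective {r : ℕ} : Function.Injective (tupBits (r := r)) := by
  intro t t' h
  funext i
  have := congrFun (List.ofFn_injective h) i
  simp only [decide_eq_decide] at this
  omega

/-- The tuples of a relation as lists. -/
noncomputable def tupList (R : Rel 2) : List (List Bool) :=
  (R.tuples.toFinite.toFinset.toList).map tupBits

theorem mem_tupList {R : Rel 2} {t : Fin R.arity → Fin 2} :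
    tupBits t ∈ tupList R ↔ t ∈ R.tuples := by
  simp [tupList, tupBits_injective.eq_iff]

/-- The tables of all relations of a language. -/
noncomputable def tables (Γ : Language 2) : List (List (List Bool)) := Γ.map tupList

/-- The arities of all relations of a language. -/
def arities (Γ : Language 2) : List ℕ := Γ.map Rel.arity

/-- The assignment `f` satisfies all constraints of the list. -/
def SatBy (tb : List (List (List Bool))) (cs : List Con) (P : ℕ × ℕ → Prop) [DecidablePred P] :
    Prop :=
  ∀ c ∈ cs, c.2.map (fun p => decide (P p)) ∈ tb.getD c.1 []

/-- Satisfiability of an instance. -/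
def RepSat (tb : List (List (List Bool))) (r : Rep) : Prop :=
  ∃ f : ℕ → ℕ, (∀ v < r.2.1, f v < r.1) ∧ SatBy tb r.2.2 fun p => f p.1 = p.2

/-- A constraint with one-hot maps and the list form of it. -/
def Matches {Γ : Language 2} {n k : ℕ} (c : Constraint Γ OH n k) (d : Con) : Prop :=
  ∃ a : Fin (Γ.get c.rel).arity → Fin n, (∀ i b, c.maps i b = if b = a i then 1 else 0) ∧
    d = ((c.rel : ℕ), (List.finRange _).map fun i => ((c.vars i : ℕ), (a i : ℕ)))

section
variable {Γ : Language 2} {n k : ℕ}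

theorem exists_matches_con (c : Constraint Γ OH n k) : ∃ d, Matches c d := by
  have h : ∀ i, ∃ a : Fin n, ∀ b, c.maps i b = if b = a then 1 else 0 := by
    intro i
    obtain ⟨-, a, ha, hu⟩ := c.maps_mem i
    refine ⟨a, fun b => ?_⟩
    split_ifs with hb
    · subst hb; omega
    · have : (c.maps i b : ℕ) ≠ 1 := fun h => hb (hu b h)
      omega
  choose a ha using h
  exact ⟨_, a, ha, rfl⟩

theorem exists_matches_constraint {d : Con} (h1 : d.1 < (arities Γ).length)
    (h2 : d.2.length = (arities Γ).getD d.1 0) (h3 : ∀ p ∈ d.2, p.1 < k ∧ p.2 < n) :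
    ∃ c : Constraint Γ OH n k, Matches c d := by
  obtain ⟨ρ, l⟩ := d
  simp only [arities, List.length_map] at h1
  have h2' : l.length = (Γ.get ⟨ρ, h1⟩).arity := by simpa [arities, h1] using h2
  have hm := fun i : Fin (Γ.get ⟨ρ, h1⟩).arity =>
    h3 (l.get (i.cast h2'.symm)) (List.get_mem _ _)
  refine ⟨⟨⟨ρ, h1⟩, fun i => ⟨_, (hm i).1⟩,
    fun i b => if b = ⟨_, (hm i).2⟩ then 1 else 0, fun i => ⟨rfl, ⟨_, (hm i).2⟩, ?_, ?_⟩⟩,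
    fun i => ⟨_, (hm i).2⟩, fun i b => rfl, Prod.ext rfl ?_⟩
  · simp
  · intro b hb
    by_contra h
    simp only [if_neg h] at hb
    simp at hb
  · refine List.ext_getElem (by simp [h2']) fun i hi hi' => ?_
    simp

theorem Matches.valid {c : Constraint Γ OH n k} {d : Con} (h : Matches c d) :
    d.1 < (arities Γ).length ∧ d.2.length = (arities Γ).getD d.1 0 ∧
      ∀ p ∈ d.2, p.1 < k ∧ p.2 < n := by
  obtain ⟨a, -, rfl⟩ := h
  refine ⟨by simp [arities], by simp [arities], fun p hp => ?_⟩
  obtain ⟨i, -, rfl⟩ := List.mem_map.1 hp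
  exact ⟨(c.vars i).2, (a i).2⟩

theorem Matches.nums {c : Constraint Γ OH n k} {d : Con} (h : Matches c d) :
    ((c.rel : ℕ) :: (List.finRange (Γ.get c.rel).arity).flatMap fun i =>
      (c.vars i : ℕ) :: List.ofFn fun a => (c.maps i a : ℕ)) = conNums n d := by
  obtain ⟨a, ha, rfl⟩ := h
  simp only [conNums, List.flatMap_map]
  congr 2
  funext i
  congr 1
  refine List.ext_getElem (by simp) fun b hb hb' => ?_
  have hbn : b < n := by simpa using hb
  by_cases h : b = a i
  · simp [ha, h]
  · have : ¬ (⟨b, hbn⟩ : Fin n) = a i := fun h' => h (congrArg Fin.val h')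
    simp [ha, h, this]

theorem Matches.sat {c : Constraint Γ OH n k} {d : Con} (h : Matches c d) (f : Fin k → Fin n)
    (g : ℕ → ℕ) (hg : ∀ v : Fin k, g v = f v) :
    (fun i => c.maps i (f (c.vars i))) ∈ (Γ.get c.rel).tuples ↔
      d.2.map (fun p => decide (g p.1 = p.2)) ∈ (tables Γ).getD d.1 [] := by
  obtain ⟨a, ha, rfl⟩ := h
  have : (tables Γ).getD c.rel [] = tupList (Γ.get c.rel) := by simp [tables]
  rw [← mem_tupList]
  simp only [this]
  refine iff_of_eq (congrArg (· ∈ tupList (Γ.get c.rel)) ?_)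
  rw [tupBits, List.map_map, ← List.ofFn_eq_map]
  congr 1
  funext i
  simp [ha, hg, Fin.ext_iff]

theorem exists_forall₂ {α β : Type} {R : α → β → Prop} {l : List β} (h : ∀ b ∈ l, ∃ a, R a b) :
    ∃ m, List.Forall₂ R m l := by
  induction l with
  | nil => exact ⟨[], .nil⟩
  | cons b l ih =>
    obtain ⟨m, hm⟩ := ih fun b hb => h b (by simp [hb])
    obtain ⟨a, ha⟩ := h b (by simp)
    exact ⟨a :: m, .cons ha hm⟩

/-- Dictionary between dependently typed instances and plain lists; `mem_oneHotCSP` uses it in both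
directions, so that all later arguments concern lists only. -/
theorem matches_list {cs : List (Constraint Γ OH n k)} {ds : List Con}
    (h : List.Forall₂ Matches cs ds) :
    ValidRep (arities Γ) (n, k, ds) ∧ (⟨n, k, cs⟩ : Instance Γ OH).encode = encRep (n, k, ds) ∧
      ((⟨n, k, cs⟩ : Instance Γ OH).Satisfiable ↔ RepSat (tables Γ) (n, k, ds)) := by
  refine ⟨?_, ?_, ?_⟩
  · intro d hd
    induction h with
    | nil => simp at hd
    | cons h _ ih =>
      rcases List.mem_cons.1 hd with rfl | hd
      · exact h.valid
      · exact ih hd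
  · simp only [Instance.encode, encRep]
    congr 3
    induction h with
    | nil => rfl
    | cons h _ ih => rw [List.flatMap_cons, List.flatMap_cons, ih, h.nums]
  · have key : ∀ (f : Fin k → Fin n) (g : ℕ → ℕ), (∀ v : Fin k, g v = f v) →
        ((∀ c ∈ cs, (fun i => c.maps i (f (c.vars i))) ∈ (Γ.get c.rel).tuples) ↔
          SatBy (tables Γ) ds fun p => g p.1 = p.2) := by
      intro f g hg
      unfold SatBy
      induction h with
      | nil => simp
      | cons h _ ih => simp only [List.forall_mem_cons, h.sat f g hg, ih]
    constructor
    · rintro ⟨f, hf⟩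
      have h := (key f (fun v => if h : v < k then f ⟨v, h⟩ else 0) (by simp)).1 hf
      refine ⟨fun v => if h : v < k then f ⟨v, h⟩ else 0, fun v hv => ?_, h⟩
      have hv : v < k := hv
      simp [hv]
    · rintro ⟨g, hg, hs⟩
      have h := (key (fun v => ⟨g v, hg v v.2⟩) g fun v => rfl).2 hs
      exact ⟨fun v => ⟨g v, hg v v.2⟩, h⟩

theorem mem_oneHotCSP {x : List (Fin 2) × ℕ} : x ∈ OneHotCSP Γ ↔
    ∃ r, ValidRep (arities Γ) r ∧ RepSat (tables Γ) r ∧ x = (encRep r, r.2.1) := by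
  constructor
  · rintro ⟨⟨n, k, cs⟩, h1, h2, h3⟩
    obtain ⟨ds, hds⟩ := exists_forall₂ (R := fun d c => Matches c d) (l := cs)
      fun c _ => exists_matches_con c
    obtain ⟨h4, h5, h6⟩ := matches_list hds.flip
    exact ⟨_, h4, h6.1 h3, Prod.ext (h1.trans h5) h2⟩
  · rintro ⟨⟨n, k, ds⟩, h1, h2, rfl⟩
    obtain ⟨cs, hcs⟩ := exists_forall₂ (R := Matches (Γ := Γ) (n := n) (k := k)) (l := ds)
      fun d hd => let h := h1 d hd; exists_matches_constraint h.1 h.2.1 h.2.2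
    obtain ⟨h4, h5, h6⟩ := matches_list hcs
    exact ⟨⟨n, k, cs⟩, h5.symm, rfl, h6.2 h2⟩

end

/-! ### The algorithm for weakly 0-separable languages -/

/-- The constraint holds for the indicator function of the list `S`. -/
def conB (tb : List (List (List Bool))) (S : List (ℕ × ℕ)) (c : Con) : Bool :=
  decide (c.2.map (fun p => decide (p ∈ S)) ∈ tb.getD c.1 [])

/-- All constraints hold for the indicator function of the list `S`. -/
def satB (tb : List (List (List Bool))) (cs : List Con) (S : List (ℕ × ℕ)) : Bool :=
  cs.all (conB tb S)

/-- Adds the `i`-th argument of the first violated constraint to `S`. -/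
def procStep (tb : List (List (List Bool))) (cs : List Con) (S : List (ℕ × ℕ)) (i : ℕ) :
    List (ℕ × ℕ) :=
  bif satB tb cs S then S else
    -- In this branch a violated constraint exists, so the first default is never used. An index
    -- beyond the arity adds the pair `(0, 0)`; this is harmless, because the outcome is tested by
    -- `okB`.
    ((cs.filter fun c => !conB tb S c).headD (0, [])).2.getD i (0, 0) :: S

/-- Repairs violated constraints, following the instructions `σ`. -/
def proc (tb : List (List (List Bool))) (cs : List Con) (S : List (ℕ × ℕ)) (σ : List ℕ) :
    List (ℕ × ℕ) :=
  σ.foldl (procStep tb cs) S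

/-- The label of the variable `u` according to the guess `g`. -/
def label (g : List (List ℕ)) (u : ℕ) : ℕ := (g.getD (u + 1) []).headD 0

/-- The instructions for the block `j` according to the guess `g`. -/
def instr (g : List (List ℕ)) (j : ℕ) : List ℕ := (g.getD j []).tail

/-- `S` is a satisfying partial assignment to the variables with label `0` or `j`. -/
def okB (tb : List (List (List Bool))) (r : Rep) (g : List (List ℕ)) (S : List (ℕ × ℕ)) (j : ℕ) :
    Bool :=
  satB tb r.2.2 S && ((S.all fun p => S.all fun q => !decide (p.1 = q.1) || decide (p.2 = q.2)) &&
    ((S.all fun p => decide (p.1 < r.2.1) && decide (p.2 < r.1)) &&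
      (List.range r.2.1).all fun u => decide ((S.any fun p => decide (p.1 = u)) =
        (decide (label g u = 0) || decide (label g u = j)))))

/-- The guess `g` leads to a satisfying assignment. -/
def checkB (tb : List (List (List Bool))) (r : Rep) (g : List (List ℕ)) : Bool :=
  okB tb r g (proc tb r.2.2 [] (instr g 0)) 0 &&
    -- Label `0` marks the variables of the common part `T`. A block with label `j + 1` is grown
    -- from `T` and the variable `j`, hence the subtraction below; the value `a` of that seed is the
    -- only thing searched for over the whole domain.
    (List.range r.2.1).all fun v => decide (label g v = 0) ||
      (List.range r.1).any fun a => okB tb r g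
        (proc tb r.2.2 ((label g v - 1, a) :: proc tb r.2.2 [] (instr g 0)) (instr g (label g v)))
        (label g v)

/-- All lists of length `q` over the list `o`. -/
def listsOf {α : Type} (o : List α) (q : ℕ) : List (List α) :=
  (fun acc => o.flatMap fun a => acc.map fun l => a :: l)^[q] [[]]

theorem mem_listsOf {α : Type} {o : List α} {q : ℕ} {l : List α} :
    l ∈ listsOf o q ↔ l.length = q ∧ ∀ a ∈ l, a ∈ o := by
  induction q generalizing l with
  | zero => simp +contextual [listsOf, List.length_eq_zero_iff]
  | succ q ih =>
    rw [listsOf, Function.iterate_succ_apply', ← listsOf]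
    simp only [List.mem_flatMap, List.mem_map, ih]
    constructor
    · rintro ⟨a, ha, l, ⟨h1, h2⟩, rfl⟩
      exact ⟨by simp [h1], by simpa [ha] using h2⟩
    · rintro ⟨h1, h2⟩
      cases l with
      | nil => simp at h1
      | cons a l =>
        exact ⟨a, h2 a (by simp), l, ⟨by simpa using h1, fun b hb => h2 b (by simp [hb])⟩, rfl⟩

/-- The guesses for `k` variables, if all arities are at most `s`. -/
def guesses (s k : ℕ) : List (List (List ℕ)) :=
  -- Row `0` serves `T`, and row `v + 1` starts with the label of `v`. The other `k` entries of row
  -- `j` direct the growth of block `j`. Labels are at most `k` and argument positions at most `s`.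
  listsOf (listsOf (List.range (k + s + 1)) (k + 1)) (k + 1)

/-- `S` satisfies the constraints. -/
abbrev Sat (tb : List (List (List Bool))) (cs : List Con) (S : List (ℕ × ℕ)) : Prop :=
  SatBy tb cs (· ∈ S)

theorem conB_iff {tb : List (List (List Bool))} {S : List (ℕ × ℕ)} {c : Con} :
    conB tb S c = true ↔ c.2.map (fun p => decide (p ∈ S)) ∈ tb.getD c.1 [] := by
  simp only [conB, decide_eq_true_eq]

theorem satB_iff {tb : List (List (List Bool))} {cs : List Con} {S : List (ℕ × ℕ)} :
    satB tb cs S = true ↔ Sat tb cs S := by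
  simp only [satB, List.all_eq_true, conB_iff, Sat, SatBy]

theorem SatBy.congr {ar : List ℕ} {tb : List (List (List Bool))} {r : Rep} (hr : ValidRep ar r)
    {P Q : ℕ × ℕ → Prop} [DecidablePred P] [DecidablePred Q] (h : SatBy tb r.2.2 P)
    (hPQ : ∀ p, p.1 < r.2.1 → (P p ↔ Q p)) : SatBy tb r.2.2 Q := by
  intro c hc
  have : c.2.map (fun p => decide (Q p)) = c.2.map (fun p => decide (P p)) :=
    List.map_congr_left fun p hp => by simp [hPQ p ((hr c hc).2.2 p hp).1]
  rw [this]
  exact h c hc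

/-- The indicator function of a list. -/
def ind (S : List (ℕ × ℕ)) (p : ℕ × ℕ) : Fin 2 := if p ∈ S then 1 else 0

/-! ### Closure properties of satisfying sets, soundness of the check, and growth by repairs -/

section
variable {Γ : Language 2} {r : Rep}

/-- Each constraint reads some coordinates of the indicator functions, so a partial operation that
preserves the relations acts on satisfying sets, provided that it is defined at every pair with a
genuine variable. -/
theorem Sat.of_preserves {g : Fin 2 → Fin 2 → Fin 2 → Option (Fin 2)}
    (hg : ∀ R ∈ Γ, R.Preserves g) (hr : ValidRep (arities Γ) r) {S₁ S₂ S₃ S : List (ℕ × ℕ)}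
    (h₁ : Sat (tables Γ) r.2.2 S₁) (h₂ : Sat (tables Γ) r.2.2 S₂) (h₃ : Sat (tables Γ) r.2.2 S₃)
    (h : ∀ p : ℕ × ℕ, p.1 < r.2.1 → g (ind S₁ p) (ind S₂ p) (ind S₃ p) = some (ind S p)) :
    Sat (tables Γ) r.2.2 S := by
  intro c hc
  obtain ⟨hc1, hc2, hc3⟩ := hr c hc
  simp only [arities, List.length_map] at hc1
  have hlen : c.2.length = (Γ[c.1]).arity := by simpa [arities, hc1] using hc2
  have htb : (tables Γ).getD c.1 [] = tupList Γ[c.1] := by simp [tables, hc1]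
  have key : ∀ S : List (ℕ × ℕ), (c.2.map (fun p => decide (p ∈ S)) ∈ (tables Γ).getD c.1 []) ↔
      (fun i : Fin Γ[c.1].arity => ind S (c.2.get (i.cast hlen.symm))) ∈ Γ[c.1].tuples := by
    intro S
    rw [← mem_tupList, htb]
    refine iff_of_eq (congrArg (· ∈ tupList Γ[c.1]) ?_)
    refine List.ext_getElem (by simp [tupBits, hlen]) fun i hi hi' => ?_
    simp [tupBits, ind]
  rw [key]
  refine hg _ (List.getElem_mem hc1) _ ((key _).1 (h₁ c hc)) _ ((key _).1 (h₂ c hc)) _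
    ((key _).1 (h₃ c hc)) _ fun i => h _ (hc3 _ (List.get_mem _ _)).1

/-- Apply `fNand` to the indicators of `T`, `S`, `S'`: it is defined because the two sets meet only
in `T`, and it yields their union. -/
theorem Sat.union (hΓ : WeaklyZeroSeparable Γ) (hr : ValidRep (arities Γ) r)
    {T S S' : List (ℕ × ℕ)} (hT : Sat (tables Γ) r.2.2 T) (hS : Sat (tables Γ) r.2.2 S)
    (hS' : Sat (tables Γ) r.2.2 S') (h : T ⊆ S) (h' : T ⊆ S')
    (hi : ∀ p : ℕ × ℕ, p.1 < r.2.1 → p ∈ S → p ∈ S' → p ∈ T) :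
    Sat (tables Γ) r.2.2 (S ++ S') := by
  refine Sat.of_preserves (fun R hR => (hΓ R hR).1) hr hT hS hS' fun p hp => ?_
  have h1 := @h p
  have h2 := @h' p
  have h3 := hi p hp
  unfold ind
  by_cases hpT : p ∈ T
  · simp [hpT, h1 hpT, h2 hpT, fNand]
  · by_cases hpS : p ∈ S
    · by_cases hpS' : p ∈ S'
      · exact absurd (h3 hpS hpS') hpT
      · simp [hpT, hpS, hpS', fNand]
    · by_cases hpS' : p ∈ S'
      · simp [hpT, hpS, hpS', fNand]
      · simp [hpT, hpS, hpS', fNand]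

/-- Apply `gImpl` along the chain `T ⊆ S ⊆ G`: this cuts `S \ T` out of `G`. -/
theorem Sat.diff (hΓ : WeaklyZeroSeparable Γ) (hr : ValidRep (arities Γ) r)
    {T S G : List (ℕ × ℕ)} (hT : Sat (tables Γ) r.2.2 T) (hS : Sat (tables Γ) r.2.2 S)
    (hG : Sat (tables Γ) r.2.2 G) (h : T ⊆ S) (h' : S ⊆ G) :
    Sat (tables Γ) r.2.2 (G.filter fun p => decide (p ∈ T ∨ p ∉ S)) := by
  refine Sat.of_preserves (fun R hR => (hΓ R hR).2) hr hT hS hG fun p hp => ?_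
  have h1 := @h p
  have h2 := @h' p
  unfold ind
  by_cases hpT : p ∈ T
  · simp [hpT, h1 hpT, h2 (h1 hpT), gImpl]
  · by_cases hpS : p ∈ S
    · simp [hpT, hpS, h2 hpS, gImpl]
    · by_cases hpS' : p ∈ G
      · simp [hpT, hpS, hpS', gImpl]
      · simp [hpT, hpS, hpS', gImpl]

theorem subset_proc (tb : List (List (List Bool))) (cs : List Con) (S : List (ℕ × ℕ))
    (σ : List ℕ) : S ⊆ proc tb cs S σ := by
  induction σ generalizing S with
  | nil => exact fun _ h => h
  | cons i σ ih =>
    refine List.Subset.trans ?_ (ih (procStep tb cs S i))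
    unfold procStep
    cases satB tb cs S
    · exact List.subset_cons_self _ _
    · exact List.Subset.refl _

theorem proc_of_sat {tb : List (List (List Bool))} {cs : List Con} {S : List (ℕ × ℕ)}
    (h : satB tb cs S = true) (σ : List ℕ) : proc tb cs S σ = S := by
  induction σ with
  | nil => rfl
  | cons i σ ih =>
    have : procStep tb cs S i = S := by simp [procStep, h]
    rw [proc, List.foldl_cons, this]
    exact ih

/-- `S` is a satisfying partial assignment to the variables in `D`. -/
def Ok (tb : List (List (List Bool))) (r : Rep) (S : List (ℕ × ℕ)) (D : ℕ → Prop) : Prop :=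
  Sat tb r.2.2 S ∧ (∀ p ∈ S, ∀ q ∈ S, p.1 = q.1 → p.2 = q.2) ∧
    (∀ p ∈ S, p.1 < r.2.1 ∧ p.2 < r.1) ∧ ∀ u < r.2.1, (∃ p ∈ S, p.1 = u) ↔ D u

theorem okB_iff {tb : List (List (List Bool))} {g : List (List ℕ)} {S : List (ℕ × ℕ)} {j : ℕ} :
    okB tb r g S j = true ↔ Ok tb r S fun u => label g u = 0 ∨ label g u = j := by
  have hb : ∀ a b c : Bool, (a = (b || c)) ↔ (a = true ↔ (b = true ∨ c = true)) := by decide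
  simp only [okB, Ok, Bool.and_eq_true, satB_iff, List.all_eq_true, Bool.or_eq_true,
    Bool.not_eq_true', decide_eq_false_iff_not, decide_eq_true_eq, List.mem_range,
    hb, List.any_eq_true, imp_iff_not_or]

/-- The blocks are glued in the order of their labels. The labels fix the variables of each block in
advance, so independently chosen blocks overlap only in `T` and `Sat.union` applies. -/
theorem repSat_of_checkB (hΓ : WeaklyZeroSeparable Γ) (hr : ValidRep (arities Γ) r)
    {g : List (List ℕ)} (h : checkB (tables Γ) r g = true) : RepSat (tables Γ) r := by
  simp only [checkB, Bool.and_eq_true, List.all_eq_true, List.mem_range, Bool.or_eq_true,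
    decide_eq_true_eq, List.any_eq_true, okB_iff, or_self] at h
  obtain ⟨hT, hb⟩ := h
  set T := proc (tables Γ) r.2.2 [] (instr g 0)
  have key : ∀ j, ∃ S, T ⊆ S ∧ Ok (tables Γ) r S fun u => label g u ≤ j := by
    intro j
    induction j with
    | zero => exact ⟨T, List.Subset.refl _, by simpa using hT⟩
    | succ j ih =>
      obtain ⟨S, hTS, hS1, hS2, hS3, hS4⟩ := ih
      by_cases hv : ∃ v < r.2.1, label g v = j + 1
      · obtain ⟨v, hv, hvj⟩ := hv
        obtain h0 | ⟨a, ha, hok⟩ := hb v hv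
        · omega
        rw [hvj] at hok
        have hTS' := List.Subset.trans (List.subset_cons_self _ _) (subset_proc (tables Γ) r.2.2
          ((j + 1 - 1, a) :: T) (instr g (j + 1)))
        generalize proc (tables Γ) r.2.2 ((j + 1 - 1, a) :: T) (instr g (j + 1)) = S' at hok hTS'
        obtain ⟨hS1', hS2', hS3', hS4'⟩ := hok
        -- A common variable has a label that is at most `j` and also `0` or `j + 1`, so it is `0`.
        -- Then `T` assigns this variable, and both sets agree with `T` there.
        have hcap : ∀ p ∈ S, ∀ q ∈ S', p.1 = q.1 → p ∈ T ∧ q ∈ T := by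
          intro p hp q hq hpq
          have h1 := (hS4 p.1 (hS3 p hp).1).1 ⟨p, hp, rfl⟩
          have h2 := (hS4' p.1 (hS3 p hp).1).1 ⟨q, hq, hpq.symm⟩
          obtain ⟨t, ht, ht'⟩ := (hT.2.2.2 p.1 (hS3 p hp).1).2 (by omega)
          have h3 := hS2 p hp t (hTS ht) ht'.symm
          have h4 := hS2' q hq t (hTS' ht) (by rw [ht', hpq])
          rw [show p = t from Prod.ext ht'.symm h3, show q = t from Prod.ext (by rw [ht', hpq]) h4]
          exact ⟨ht, ht⟩
        refine ⟨S ++ S', List.subset_append_of_subset_left _ hTS,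
          Sat.union hΓ hr hT.1 hS1 hS1' hTS hTS' fun p _ hp hp' => (hcap p hp p hp' rfl).1, ?_, ?_,
          ?_⟩
        · intro p hp q hq hpq
          rcases List.mem_append.1 hp with hp | hp <;> rcases List.mem_append.1 hq with hq | hq
          · exact hS2 p hp q hq hpq
          · obtain ⟨h1, h2⟩ := hcap p hp q hq hpq
            exact hS2 p (hTS h1) q (hTS h2) hpq
          · obtain ⟨h1, h2⟩ := hcap q hq p hp hpq.symm
            exact hS2 p (hTS h2) q (hTS h1) hpq
          · exact hS2' p hp q hq hpq
        · intro p hp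
          rcases List.mem_append.1 hp with hp | hp
          · exact hS3 p hp
          · exact hS3' p hp
        · intro u hu
          have h1 := hS4 u hu
          have h2 := hS4' u hu
          simp only [List.mem_append, or_and_right, exists_or, h1, h2]
          omega
      · refine ⟨S, hTS, hS1, hS2, hS3, fun u hu => ?_⟩
        have : label g u ≠ j + 1 := fun h => hv ⟨u, hu, h⟩
        rw [hS4 u hu]
        omega
  -- At the largest label every variable is assigned, and the set is the graph of a total
  -- assignment.
  obtain ⟨S, -, hS1, hS2, hS3, hS4⟩ := key ((Finset.range r.2.1).sup (label g))
  have hdom : ∀ u, ∃ a, u < r.2.1 → (u, a) ∈ S := by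
    intro u
    by_cases hu : u < r.2.1
    · obtain ⟨p, hp, rfl⟩ := (hS4 u hu).2 (Finset.le_sup (f := label g) (Finset.mem_range.2 hu))
      exact ⟨p.2, fun _ => hp⟩
    · exact ⟨0, fun h => absurd h hu⟩
  choose f hf using hdom
  refine ⟨f, fun v hv => (hS3 _ (hf v hv)).2, SatBy.congr hr hS1 fun p hp => ?_⟩
  constructor
  · intro h
    exact hS2 _ (hf p.1 hp) p h rfl
  · intro h
    have := hf p.1 hp
    rwa [h] at this

theorem length_filter_lt_length_filter {α : Type} {l : List α} {p q : α → Bool} {a : α}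
    (hpq : ∀ b ∈ l, p b = true → q b = true) (ha : a ∈ l) (hq : q a = true)
    (hp : ¬ p a = true) : (l.filter p).length < (l.filter q).length := by
  have : l.filter p = (l.filter q).filter p := by
    rw [List.filter_filter]
    refine List.filter_congr fun b hb => ?_
    have := hpq b hb
    cases h : p b <;> simp_all
  rw [this]
  exact List.length_filter_lt_length_iff_exists.2 ⟨a, List.mem_filter.2 ⟨ha, hq⟩, hp⟩

/-- A constraint that holds for `G` but fails for `S ⊆ G` has an argument in `G \ S`; the
instruction is to add this argument. Every such step shrinks `G \ S`, so `m` steps suffice. -/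
theorem exists_proc {tb : List (List (List Bool))} {cs : List Con} {B : ℕ}
    (hB : ∀ c ∈ cs, c.2.length ≤ B) {G : List (ℕ × ℕ)} (hG : Sat tb cs G) (m : ℕ)
    (S : List (ℕ × ℕ)) (hS : S ⊆ G) (hm : (G.filter fun p => decide (p ∉ S)).length ≤ m) :
    ∃ σ : List ℕ, σ.length = m ∧ (∀ i ∈ σ, i < B + 1) ∧ Sat tb cs (proc tb cs S σ) ∧
      proc tb cs S σ ⊆ G := by
  induction m generalizing S with
  | zero =>
    refine ⟨[], rfl, by simp, ?_, hS⟩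
    intro c hc
    have hGS : ∀ p ∈ G, p ∈ S := by
      intro p hp
      by_contra h
      have := List.length_pos_of_mem (List.mem_filter.2 ⟨hp, decide_eq_true h⟩ :
        p ∈ G.filter fun p => decide (p ∉ S))
      omega
    have : c.2.map (fun p => decide (p ∈ S)) = c.2.map (fun p => decide (p ∈ G)) :=
      List.map_congr_left fun p _ => decide_eq_decide.2 ⟨@hS p, hGS p⟩
    have h := hG c hc
    rw [← this] at h
    exact h
  | succ m ih =>
    by_cases hs : satB tb cs S = true
    -- Satisfying sets ignore instructions, so zeros pad the sequence to its prescribed length.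
    · refine ⟨List.replicate (m + 1) 0, by simp, by simp, ?_, ?_⟩ <;> rw [proc_of_sat hs]
      · exact satB_iff.1 hs
      · exact hS
    · have hne : (cs.filter fun c => !conB tb S c) ≠ [] := by
        intro h
        refine hs (List.all_eq_true.2 fun c hc => ?_)
        simpa using List.filter_eq_nil_iff.1 h c hc
      obtain ⟨c, l, hcl⟩ := List.exists_cons_of_ne_nil hne
      have hc := List.mem_filter.1 (hcl ▸ List.mem_cons_self : c ∈ cs.filter fun c => !conB tb S c)
      obtain ⟨hc, hc'⟩ := hc
      have : ∃ p ∈ c.2, p ∈ G ∧ p ∉ S := by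
        by_contra! h
        have h1 := hG c hc
        have : c.2.map (fun p => decide (p ∈ G)) = c.2.map (fun p => decide (p ∈ S)) :=
          List.map_congr_left fun p hp => decide_eq_decide.2 ⟨h p hp, @hS p⟩
        rw [this, ← conB_iff] at h1
        simp [h1] at hc'
      obtain ⟨p, hpc, hpG, hpS⟩ := this
      obtain ⟨i, hi, rfl⟩ := List.getElem_of_mem hpc
      have hstep : procStep tb cs S i = c.2[i] :: S := by
        have : satB tb cs S = false := by simpa using hs
        simp [procStep, this, hcl, hi]
      obtain ⟨σ, h1, h2, h3, h4⟩ := ih (c.2[i] :: S) (List.cons_subset.2 ⟨hpG, hS⟩) (by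
        have hlt : (G.filter fun p => decide (p ∉ c.2[i] :: S)).length <
            (G.filter fun p => decide (p ∉ S)).length := by
          exact length_filter_lt_length_filter (a := c.2[i]) (by simp +contextual) hpG
            (by simpa using hpS) (by simp)
        omega)
      refine ⟨i :: σ, by simp [h1], ?_, ?_⟩
      · have := hB c hc
        rw [List.forall_mem_cons]
        exact ⟨by omega, h2⟩
      · rw [proc, List.foldl_cons, hstep]
        exact ⟨h3, h4⟩

end

/-! ### Decomposition of a solution into blocks, and completeness of the check -/

section
variable {Γ : Language 2} {r : Rep}

/-- Induction on the size of `G`: pick a pair of `G` outside `T`, grow a block `S` from it inside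
`G`, remove `S \ T` by `Sat.diff`, and recurse. Naming a block after its seed lets the label alone
determine the seed, whose membership in `G \ T` is part of the conclusion in order to keep labels
distinct. -/
theorem exists_blocks (hΓ : WeaklyZeroSeparable Γ) (hr : ValidRep (arities Γ) r) {B : ℕ}
    (hB : ∀ c ∈ r.2.2, c.2.length ≤ B) {f : ℕ → ℕ} (hf : ∀ v < r.2.1, f v < r.1)
    {T : List (ℕ × ℕ)} (hT : Sat (tables Γ) r.2.2 T) (m : ℕ) (G : List (ℕ × ℕ))
    (hm : G.length ≤ m) (hmk : G.length ≤ r.2.1) (hG : Sat (tables Γ) r.2.2 G)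
    (hGf : ∀ p ∈ G, p.1 < r.2.1 ∧ p.2 = f p.1) (hTG : T ⊆ G) :
    ∃ (lab : ℕ → ℕ) (σ : ℕ → List ℕ), (∀ j, (σ j).length = r.2.1 ∧ ∀ i ∈ σ j, i < B + 1) ∧
      ∀ v, (v, f v) ∈ G → (v, f v) ∉ T → 1 ≤ lab v ∧ (lab v - 1, f (lab v - 1)) ∈ G ∧
        (lab v - 1, f (lab v - 1)) ∉ T ∧
        Ok (tables Γ) r
          (proc (tables Γ) r.2.2 ((lab v - 1, f (lab v - 1)) :: T) (σ (lab v)))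
          fun u => (u, f u) ∈ T ∨ ((u, f u) ∈ G ∧ (u, f u) ∉ T ∧ lab u = lab v) := by
  induction m generalizing G with
  | zero =>
    obtain rfl : G = [] := List.length_eq_zero_iff.1 (by omega)
    exact ⟨0, fun _ => List.replicate r.2.1 0, by simp, by simp⟩
  | succ m ih =>
    by_cases h : ∀ p ∈ G, p ∈ T
    · exact ⟨0, fun _ => List.replicate r.2.1 0, by simp, fun v hv hv' => absurd (h _ hv) hv'⟩
    push Not at h
    obtain ⟨⟨v₀, a⟩, hvG, hvT⟩ := h
    obtain rfl : a = f v₀ := (hGf _ hvG).2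
    obtain ⟨σ₀, hσ1, hσ2, hS1, hSG⟩ := exists_proc hB hG r.2.1 ((v₀, f v₀) :: T)
      (List.cons_subset.2 ⟨hvG, hTG⟩) ((List.length_filter_le _ _).trans hmk)
    have hTS := subset_proc (tables Γ) r.2.2 ((v₀, f v₀) :: T) σ₀
    obtain ⟨hvS, hTS⟩ := List.cons_subset.1 hTS
    set S := proc (tables Γ) r.2.2 ((v₀, f v₀) :: T) σ₀ with hSdef
    have hlt : (G.filter fun p => decide (p ∈ T ∨ p ∉ S)).length < G.length :=
      List.length_filter_lt_length_iff_exists.2 ⟨_, hvG, by simp [hvT, hvS]⟩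
    obtain ⟨lab, σ, hσ, hlab⟩ := ih (G.filter fun p => decide (p ∈ T ∨ p ∉ S)) (by omega)
      (by omega) (Sat.diff hΓ hr hT hS1 hG hTS hSG) (fun p hp => hGf p (List.mem_filter.1 hp).1)
      (fun p hp => List.mem_filter.2 ⟨hTG hp, by simp [hp]⟩)
    simp only [List.mem_filter, decide_eq_true_eq] at hlab
    -- The seed `v₀` has been removed from the remaining set, so the recursion cannot name a block
    -- after it.
    have hne : ∀ v, (v, f v) ∈ G → (v, f v) ∉ S → lab v ≠ v₀ + 1 := by
      intro v hv hvs hl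
      have := hlab v ⟨hv, .inr hvs⟩ fun h => hvs (hTS h)
      rw [hl, Nat.add_sub_cancel] at this
      exact this.2.1.2.elim hvT (· hvS)
    refine ⟨fun u => if (u, f u) ∈ S then v₀ + 1 else lab u,
      fun j => if j = v₀ + 1 then σ₀ else σ j, fun j => ?_, fun v hv hvT' => ?_⟩
    · dsimp only
      split_ifs
      · exact ⟨hσ1, hσ2⟩
      · exact hσ j
    · dsimp only
      by_cases hvs : (v, f v) ∈ S
      · simp only [if_pos hvs, if_true, Nat.add_sub_cancel]
        refine ⟨by omega, hvG, hvT, hS1, ?_, ?_, fun u hu => ?_⟩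
        · intro p hp q hq hpq
          rw [(hGf p (hSG hp)).2, (hGf q (hSG hq)).2, hpq]
        · intro p hp
          obtain ⟨h1, h2⟩ := hGf p (hSG hp)
          exact ⟨h1, h2 ▸ hf _ h1⟩
        · have huS : (∃ p ∈ S, p.1 = u) ↔ (u, f u) ∈ S := by
            constructor
            · rintro ⟨p, hp, rfl⟩
              rwa [← (hGf p (hSG hp)).2]
            · exact fun h => ⟨_, h, rfl⟩
          rw [← hSdef, huS]
          constructor
          · intro h
            by_cases hT : (u, f u) ∈ T
            · exact .inl hT
            · exact .inr ⟨hSG h, hT, if_pos h⟩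
          · rintro (h | ⟨h1, h2, h3⟩)
            · exact hTS h
            · by_contra h
              rw [if_neg h] at h3
              exact hne u h1 h h3
      · obtain ⟨h1, h2, h3, h4⟩ := hlab v ⟨hv, .inr hvs⟩ hvT'
        simp only [if_neg hvs, if_neg (hne v hv hvs)]
        refine ⟨h1, h2.1, h3, h4.1, h4.2.1, h4.2.2.1, fun u hu => ?_⟩
        rw [h4.2.2.2 u hu]
        by_cases hus : (u, f u) ∈ S
        · simp only [hus, not_true_eq_false, or_false, if_true, (hne v hv hvs).symm, and_false]
          tauto
        · simp only [hus, not_false_eq_true, or_true, and_true, if_false]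

/-- Writes the decomposition of the graph of a solution as a guess. Growth takes at most `k` steps,
because this graph has `k` elements. -/
theorem exists_guess (hΓ : WeaklyZeroSeparable Γ) (hr : ValidRep (arities Γ) r)
    (h : RepSat (tables Γ) r) :
    ∃ g ∈ guesses (arities Γ).sum r.2.1, checkB (tables Γ) r g = true := by
  obtain ⟨f, hf, hs⟩ := h
  set G := (List.range r.2.1).map fun v => (v, f v) with hGdef
  have hGf : ∀ p, p ∈ G ↔ p.1 < r.2.1 ∧ p.2 = f p.1 := by
    intro p
    simp only [hGdef, List.mem_map, List.mem_range]
    constructor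
    · rintro ⟨v, hv, rfl⟩
      exact ⟨hv, rfl⟩
    · rintro ⟨h1, h2⟩
      exact ⟨p.1, h1, Prod.ext rfl h2.symm⟩
  have hGl : G.length = r.2.1 := by simp [hGdef]
  have hG : Sat (tables Γ) r.2.2 G := SatBy.congr hr hs fun p hp => by
    rw [hGf]
    simp [hp, eq_comm]
  have hB : ∀ c ∈ r.2.2, c.2.length ≤ (arities Γ).sum := by
    intro c hc
    obtain ⟨h1, h2, -⟩ := hr c hc
    rw [h2, List.getD_eq_getElem _ _ h1]
    exact List.le_sum_of_mem (List.getElem_mem h1)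
  obtain ⟨σT, hσ1, hσ2, hT1, hTG⟩ := exists_proc hB hG r.2.1 [] (by simp)
    ((List.length_filter_le _ _).trans hGl.le)
  set T := proc (tables Γ) r.2.2 [] σT
  obtain ⟨lab, σ, hσ, hlab⟩ := exists_blocks hΓ hr hB hf hT1 _ G le_rfl hGl.le hG
    (fun p => (hGf p).1) hTG
  -- Block labels are at least `1`, which leaves `0` free for `T`.
  set lab' : ℕ → ℕ := fun v => if (v, f v) ∈ T then 0 else lab v with hlab'
  have hG' : ∀ v < r.2.1, (v, f v) ∈ G := fun v hv => (hGf _).2 ⟨hv, rfl⟩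
  have hle : ∀ v < r.2.1, lab' v ≤ r.2.1 := by
    intro v hv
    by_cases hvT : (v, f v) ∈ T
    · simp [hlab', hvT]
    · have := ((hGf _).1 (hlab v (hG' v hv) hvT).2.1).1
      simp only [hlab', hvT, if_false]
      omega
  set g : List (List ℕ) := (0 :: σT) :: (List.range r.2.1).map fun v => lab' v :: σ (v + 1)
    with hg
  have hglab : ∀ v < r.2.1, label g v = lab' v := by
    intro v hv
    simp [label, hg, hv]
  have hginstr : ∀ j < r.2.1, instr g (j + 1) = σ (j + 1) := by
    intro v hv
    simp [instr, hg, hv]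
  refine ⟨g, ?_, ?_⟩
  · simp only [guesses, mem_listsOf, List.mem_range]
    refine ⟨by simp [hg], fun l hl => ?_⟩
    rcases List.mem_cons.1 hl with rfl | hl
    · refine ⟨by simp [hσ1], fun i hi => ?_⟩
      rcases List.mem_cons.1 hi with rfl | hi
      · omega
      · have := hσ2 i hi; omega
    · obtain ⟨v, hv, rfl⟩ := List.mem_map.1 hl
      refine ⟨by simp [(hσ _).1], fun i hi => ?_⟩
      rcases List.mem_cons.1 hi with rfl | hi
      · have := hle v (List.mem_range.1 hv); omega
      · have := (hσ _).2 i hi; omega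
  · simp only [checkB, Bool.and_eq_true, List.all_eq_true, List.mem_range, Bool.or_eq_true,
      decide_eq_true_eq, List.any_eq_true, okB_iff, or_self]
    have hT0 : proc (tables Γ) r.2.2 [] (instr g 0) = T := rfl
    have hdT : ∀ u < r.2.1, lab' u = 0 ↔ (u, f u) ∈ T := by
      intro u hu
      by_cases huT : (u, f u) ∈ T
      · simp [hlab', huT]
      · have := (hlab u (hG' u hu) huT).1
        simp only [hlab', huT, if_false, iff_false]
        omega
    rw [hT0]
    refine ⟨⟨hT1, ?_, ?_, ?_⟩, fun v hv => ?_⟩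
    · intro p hp q hq hpq
      rw [((hGf p).1 (hTG hp)).2, ((hGf q).1 (hTG hq)).2, hpq]
    · intro p hp
      obtain ⟨h1, h2⟩ := (hGf p).1 (hTG hp)
      exact ⟨h1, h2 ▸ hf _ h1⟩
    · intro u hu
      beta_reduce
      rw [hglab u hu, hdT u hu]
      constructor
      · rintro ⟨p, hp, rfl⟩
        rwa [← ((hGf p).1 (hTG hp)).2]
      · exact fun h => ⟨_, h, rfl⟩
    · rw [hglab v hv, hdT v hv]
      by_cases hvT : (v, f v) ∈ T
      · exact .inl hvT
      · right
        obtain ⟨h1, h2, h3, h4⟩ := hlab v (hG' v hv) hvT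
        have h5 : lab' v = lab v := by simp [hlab', hvT]
        have h6 := ((hGf _).1 h2).1
        have h7 : instr g (lab v) = σ (lab v) := by
          have := hginstr (lab v - 1) h6
          rwa [Nat.sub_add_cancel h1] at this
        refine ⟨f (lab v - 1), hf _ h6, ?_⟩
        rw [h5, h7]
        refine ⟨h4.1, h4.2.1, h4.2.2.1, fun u hu => ?_⟩
        rw [h4.2.2.2 u hu]
        beta_reduce
        rw [hglab u hu, hdT u hu]
        by_cases huT : (u, f u) ∈ T
        · simp [huT]
        · simp [huT, hlab', hG' u hu]

end

/-! ### Running time of the check, and computable bounds for the list of guesses -/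

section
variable {α β γ δ : Type} [Enc α] [Enc β] [Enc γ] [Enc δ]

@[fun_prop]
theorem pt_conB {tb : γ → List (List (List Bool))} {S : γ → List (ℕ × ℕ)} {c : γ → Con}
    (ht : PT tb) (hS : PT S) (hc : PT c) : PT (fun x => conB (tb x) (S x) (c x)) := by
  unfold conB
  fun_prop

@[fun_prop]
theorem pt_satB {tb : γ → List (List (List Bool))} {S : γ → List (ℕ × ℕ)} {cs : γ → List Con}
    (ht : PT tb) (hS : PT S) (hc : PT cs) : PT (fun x => satB (tb x) (cs x) (S x)) := by
  unfold satB
  fun_prop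

@[fun_prop]
theorem pt_procStep {tb : γ → List (List (List Bool))} {S : γ → List (ℕ × ℕ)}
    {cs : γ → List Con} {i : γ → ℕ} (ht : PT tb) (hS : PT S) (hc : PT cs) (hi : PT i) :
    PT (fun x => procStep (tb x) (cs x) (S x) (i x)) := by
  unfold procStep
  fun_prop

theorem sz_getD_le (l : List α) (i : ℕ) (d : α) : sz (l.getD i d) ≤ sz l + sz d := by
  by_cases h : i < l.length
  · rw [List.getD_eq_getElem _ _ h]
    have := sz_le_of_mem (List.getElem_mem h)
    omega
  · rw [List.getD_eq_default _ _ (by omega)]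
    omega

/-- The added pair comes from `cs` or is the default, so the growth does not depend on `S`, as
`PT.foldl` demands. The default pair and the new list node account for the 4. -/
theorem sz_procStep_le (tb : List (List (List Bool))) (cs : List Con) (S : List (ℕ × ℕ)) (i : ℕ) :
    sz (procStep tb cs S i) ≤ sz S + (sz cs + 4) := by
  unfold procStep
  cases satB tb cs S
  · rw [cond_false, sz_cons]
    have h1 := sz_getD_le ((cs.filter fun c => !conB tb S c).headD (0, [])).2 i (0, 0)
    have h2 : sz ((cs.filter fun c => !conB tb S c).headD (0, [])).2 ≤ sz cs := by
      cases h : cs.filter fun c => !conB tb S c with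
      | nil => simp; exact one_le_sz _
      | cons c l =>
        have := sz_le_of_mem (List.mem_filter.1 (h ▸ List.mem_cons_self :
          c ∈ cs.filter fun c => !conB tb S c)).1
        simp only [sz_pair] at this
        simp only [List.headD_cons]
        omega
    rw [sz_pair (0, 0)] at h1
    simp only [sz_nat] at h1
    omega
  · simp

@[fun_prop]
theorem pt_proc {tb : γ → List (List (List Bool))} {S : γ → List (ℕ × ℕ)} {cs : γ → List Con}
    {σ : γ → List ℕ} (ht : PT tb) (hS : PT S) (hc : PT cs) (hσ : PT σ) :
    PT (fun x => proc (tb x) (cs x) (S x) (σ x)) :=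
  PT.foldl (f := fun x => procStep (tb x) (cs x)) hσ hS (by fun_prop) (fun x => sz (cs x) + 4)
    (hc.size.add (PB.const 4)) fun _ _ _ _ => sz_procStep_le _ _ _ _

@[fun_prop]
theorem pt_okB {tb : γ → List (List (List Bool))} {r : γ → Rep} {g : γ → List (List ℕ)}
    {S : γ → List (ℕ × ℕ)} {j : γ → ℕ} (ht : PT tb) (hr : PT r) (hg : PT g) (hS : PT S)
    (hj : PT j) : PT (fun x => okB (tb x) (r x) (g x) (S x) (j x)) := by
  unfold okB label
  fun_prop

@[fun_prop]
theorem pt_checkB {tb : γ → List (List (List Bool))} {r : γ → Rep} {g : γ → List (List ℕ)}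
    (ht : PT tb) (hr : PT r) (hg : PT g) : PT (fun x => checkB (tb x) (r x) (g x)) := by
  unfold checkB label instr
  fun_prop

/-- Decidable version of `ValidRep`. -/
def validB (ar : List ℕ) (r : Rep) : Bool :=
  r.2.2.all fun c => decide (c.1 < ar.length) && (decide (c.2.length = ar.getD c.1 0) &&
    c.2.all fun p => decide (p.1 < r.2.1) && decide (p.2 < r.1))

@[fun_prop]
theorem pt_validB (ar : List ℕ) {r : γ → Rep} (hr : PT r) : PT (fun x => validB ar (r x)) := by
  unfold validB
  fun_prop

omit [Enc α] [Enc β] [Enc γ] [Enc δ] in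
theorem validB_iff {ar : List ℕ} {r : Rep} : validB ar r = true ↔ ValidRep ar r := by
  simp [validB, ValidRep]

/-! ### Computable time bounds -/

/-- `f` is computed by a program with a computable bound for the time and the output size. -/
def CT (f : α → β) : Prop :=
  ∃ (p : Prog) (B : ℕ → ℕ), Computable B ∧ Monotone B ∧
    ∀ x, (∃ t ≤ B (sz x), Run p (enc x) (enc (f x)) t) ∧ sz (f x) ≤ B (sz x)

theorem computable_add {f g : ℕ → ℕ} (hf : Computable f) (hg : Computable g) :
    Computable fun n => f n + g n := Primrec.nat_add.to_comp.comp hf hg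

theorem computable_mul {f g : ℕ → ℕ} (hf : Computable f) (hg : Computable g) :
    Computable fun n => f n * g n := Primrec.nat_mul.to_comp.comp hf hg

theorem computable_pow {f : ℕ → ℕ} (hf : Computable f) (c : ℕ) :
    Computable fun n => f n ^ c := by
  induction c with
  | zero => simpa using Computable.const 1
  | succ c ih => simpa only [pow_succ] using computable_mul ih hf

theorem PT.ct {f : α → β} (h : PT f) : CT f := by
  obtain ⟨p, T, hp, ⟨c, hc⟩, ⟨d, hd⟩⟩ := h
  refine ⟨p, fun n => (n + 2) ^ c + (n + 2) ^ d, ?_, ?_, fun x => ⟨?_, ?_⟩⟩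
  · have := computable_add Computable.id (Computable.const 2)
    exact computable_add (computable_pow this c) (computable_pow this d)
  · intro m n h
    exact Nat.add_le_add (Nat.pow_le_pow_left (by omega) c) (Nat.pow_le_pow_left (by omega) d)
  · obtain ⟨t, ht, hr⟩ := hp x
    exact ⟨t, (ht.trans (hc x)).trans (Nat.le_add_right _ _), hr⟩
  · exact (hd x).trans (Nat.le_add_left _ _)

theorem CT.comp {g : β → γ} {f : α → β} (hg : CT g) (hf : CT f) : CT (fun x => g (f x)) := by
  obtain ⟨p, B, hB, hBm, hp⟩ := hf
  obtain ⟨q, C, hC, hCm, hq⟩ := hg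
  refine ⟨.seq p q, fun n => B n + C (B n) + 1, computable_add (computable_add hB (hC.comp hB))
    (Computable.const 1), fun m n h => ?_, fun x => ?_⟩
  · exact Nat.add_le_add_right (Nat.add_le_add (hBm h) (hCm (hBm h))) 1
  · obtain ⟨⟨t, ht, hr⟩, hs⟩ := hp x
    obtain ⟨⟨u, hu, hr'⟩, hs'⟩ := hq (f x)
    have := hCm hs
    exact ⟨⟨t + u + 1, by beta_reduce; omega, .seq hr hr'⟩, by beta_reduce; omega⟩

theorem CT.pair {f : α → β} {g : α → γ} (hf : CT f) (hg : CT g) : CT (fun x => (f x, g x)) := by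
  obtain ⟨p, B, hB, hBm, hp⟩ := hf
  obtain ⟨q, C, hC, hCm, hq⟩ := hg
  refine ⟨.cons p q, fun n => B n + C n + 1, computable_add (computable_add hB hC)
    (Computable.const 1), fun m n h => ?_, fun x => ?_⟩
  · exact Nat.add_le_add_right (Nat.add_le_add (hBm h) (hCm h)) 1
  · obtain ⟨⟨t, ht, hr⟩, hs⟩ := hp x
    obtain ⟨⟨u, hu, hr'⟩, hs'⟩ := hq x
    refine ⟨⟨t + u + 1, by beta_reduce; omega, .cons hr hr'⟩, ?_⟩
    simp only [sz_pair]
    omega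

/-- Bound for the size of iterates. -/
def iterBound (C : ℕ → ℕ) (b S : ℕ) (i : ℕ) : ℕ := Nat.rec b (fun _ s => s + C (S + s + 3)) i

/-- Sizes may now compound; `iterBound` tracks them by primitive recursion, which keeps the bound
computable. Monotonicity allows actual sizes to be replaced by bounds. The 3 is the size overhead of
the triple of context, accumulator and unit. -/
theorem CT.iterate {n : γ → ℕ} {b : γ → β} {f : γ → β → β} (hn : CT n) (hb : CT b)
    (hf : CT (fun p : γ × β => f p.1 p.2)) : CT (fun x => (f x)^[n x] (b x)) := by
  have hf' : CT (fun p : γ × β × Unit => f p.1 p.2.1) :=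
    CT.comp (g := fun p : γ × β => f p.1 p.2) hf (f := fun p : γ × β × Unit => (p.1, p.2.1))
      (PT.ct (by fun_prop))
  obtain ⟨p, A, hA, hAm, hp⟩ := CT.comp (g := fun n => List.replicate n ()) (PT.ct (by fun_prop)) hn
  obtain ⟨q, B, hB, hBm, hq⟩ := hb
  obtain ⟨r, C, hC, hCm, hr⟩ := hf'
  have hinf : ∀ b S i, iterBound C b S i ≤ iterBound C b S (i + 1) := fun b S i =>
    Nat.le_add_right _ _
  have him : ∀ b S, Monotone (iterBound C b S) := fun b S => monotone_nat_of_le_succ (hinf b S)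
  have hmm : ∀ b b' S S' i, b ≤ b' → S ≤ S' → iterBound C b S i ≤ iterBound C b' S' i := by
    intro b b' S S' i hb hS
    induction i with
    | zero => exact hb
    | succ i ih => exact Nat.add_le_add ih (hCm (Nat.add_le_add_right (Nat.add_le_add hS ih) 3))
  let M : ℕ → ℕ := fun S => iterBound C (B S) S (A S)
  have hM : Computable M := by
    refine Computable.nat_rec (h := fun S p => p.2 + C (S + p.2 + 3)) hA hB ?_
    have h2 : Computable fun x : ℕ × ℕ × ℕ => x.2.2 := Computable.snd.comp Computable.snd
    exact Primrec.nat_add.to_comp.comp h2 (hC.comp (Primrec.nat_add.to_comp.comp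
      (Primrec.nat_add.to_comp.comp Computable.fst h2) (Computable.const 3)))
  have hMm : Monotone M := fun S S' h => (hmm _ _ _ _ _ (hBm h) h).trans (him _ _ (hAm h))
  have hsz : ∀ x i, i ≤ A (sz x) → sz ((f x)^[i] (b x)) ≤ M (sz x) := by
    intro x i hi
    refine le_trans ?_ (him _ _ hi)
    clear hi
    induction i with
    | zero => exact (hq x).2
    | succ i ih =>
      rw [Function.iterate_succ_apply']
      refine (hr (x, _, ())).2.trans (le_trans (hCm ?_) (Nat.le_add_left _ _))
      simp only [sz_pair, sz_unit]
      exact le_trans (by omega) (Nat.add_le_add_right (Nat.add_le_add_left ih (sz x)) 3)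
  refine ⟨foldProg p q r, fun S => A S + B S + (A S + 1) * (C (S + M S + 3) + 30) + M S, ?_, ?_,
    fun x => ?_⟩
  · have hc : ∀ m : ℕ, Computable fun _ : ℕ => m := fun m => Computable.const m
    exact computable_add (computable_add (computable_add hA hB) (computable_mul
      (computable_add hA (hc 1)) (computable_add (hC.comp (computable_add (computable_add
        Computable.id hM) (hc 3))) (hc 30)))) hM
  · intro S S' h
    have := hCm (by have := hMm h; omega : S + M S + 3 ≤ S' + M S' + 3)
    exact Nat.add_le_add (Nat.add_le_add (Nat.add_le_add (hAm h) (hBm h)) (Nat.mul_le_mul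
      (Nat.add_le_add_right (hAm h) 1) (Nat.add_le_add_right this 30))) (hMm h)
  · obtain ⟨⟨t, ht, hrt⟩, hst⟩ := hp x
    obtain ⟨⟨u, hu, hru⟩, -⟩ := hq x
    have hlen := length_lt_sz (List.replicate (n x) ())
    rw [List.length_replicate] at hlen
    have hfold : ∀ i, (List.replicate i ()).foldl (fun b _ => f x b) (b x) = (f x)^[i] (b x) :=
      fun i => foldl_units _ _ _
    obtain ⟨v, hv, hrv⟩ := foldProg_run (f := fun b _ => f x b) (step := r) (C (sz x + M (sz x) + 3))
      hrt hru (by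
        intro l₁ a l₂ h
        obtain ⟨h1, h2, h3⟩ := List.replicate_eq_append_iff.1 h
        obtain ⟨⟨w, hw, hrw⟩, -⟩ := hr (x, l₁.foldl (fun b _ => f x b) (b x), a)
        refine ⟨w, hw.trans (hCm ?_), hrw⟩
        have h4 := hsz x l₁.length (by dsimp only at hst; omega)
        rw [h2, hfold]
        simp only [sz_pair, sz_unit]
        omega)
    rw [hfold] at hrv
    rw [List.length_replicate] at hv
    dsimp only at hst
    refine ⟨⟨v, hv.trans ?_, hrv⟩, (hsz x _ (by omega)).trans (Nat.le_add_left _ _)⟩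
    have := Nat.mul_le_mul_right (C (sz x + M (sz x) + 3) + 30)
      (by omega : n x + 1 ≤ A (sz x) + 1)
    beta_reduce
    omega

theorem ct_guesses (s : ℕ) : CT (guesses s) := by
  have h : ∀ {α : Type} [Enc α] {o : ℕ → List α}, CT o → CT fun k => listsOf (o k) (k + 1) := by
    intro α _ o ho
    have h2 : CT fun x : List α × ℕ => listsOf x.1 x.2 :=
      CT.iterate (f := fun (x : List α × ℕ) acc => x.1.flatMap fun a => acc.map fun l => a :: l)
        (PT.ct (by fun_prop)) (PT.ct (by fun_prop)) (PT.ct (by fun_prop))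
    exact CT.comp (g := fun x : List α × ℕ => listsOf x.1 x.2) h2 (CT.pair ho (PT.ct (by fun_prop)))
  exact h (h (PT.ct (by fun_prop)))

theorem sz_input_le {s : ℕ} (w : List (Fin s)) (k : ℕ) :
    sz (w, k) ≤ 2 * s * w.length + 2 * k + 3 := by
  have : sz w ≤ 2 * s * w.length + 1 := by
    induction w with
    | nil => simp
    | cons a w ih =>
      have := a.2
      simp only [sz_cons, sz_fin, List.length_cons, mul_add]
      omega
  simp only [sz_pair, sz_nat]
  omega

/-- A problem is in FPT if it can be decided in polynomial time from the input and some
object that is computable from the parameter. -/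
theorem FPT.of_advice {s : ℕ} {L : ParamProblem s} {G : ℕ → δ}
    {chk : (List (Fin s) × ℕ) × δ → Bool} (hc : PT chk) (hG : CT G)
    (h : ∀ x, x ∈ L ↔ chk (x, G x.2) = true) : FPT L := by
  obtain ⟨p, T, hp, ⟨c, hT⟩, -⟩ := hc
  obtain ⟨q, B, hB, hBm, hq⟩ := hG
  refine ⟨.seq (.cons .skip (.seq .tl q)) p,
    fun k => B (2 * k + 1) + 6 + (2 * s + 2 * k + 6 + B (2 * k + 1)) ^ c, c, ?_, fun w k => ?_⟩
  · have hk : Computable fun k : ℕ => 2 * k := computable_mul (Computable.const 2) Computable.id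
    have hBk := hB.comp (computable_add hk (Computable.const 1))
    exact computable_add (computable_add hBk (Computable.const 6)) (computable_pow (computable_add
      (computable_add (computable_add (Computable.const _) hk) (Computable.const 6)) hBk) c)
  · obtain ⟨⟨t, ht, hrt⟩, hst⟩ := hq k
    obtain ⟨u, hu, hru⟩ := hp ((w, k), G k)
    rw [sz_nat] at ht hst
    rw [enc_input]
    refine ⟨enc (chk ((w, k), G k)), 1 + (1 + t + 1) + 1 + u + 1,
      .seq (.cons (.skip _) (.seq (.tl _) hrt)) hru, ?_, ?_⟩
    · have h1 := hT ((w, k), G k)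
      have h2 := sz_input_le w k
      -- Bounding the size by a product of a function of `k` and `w.length + 1` makes its `c`-th
      -- power split into the two factors of an FPT bound.
      have h3 : sz ((w, k), G k) + 2 ≤
          (2 * s + 2 * k + 6 + B (2 * k + 1)) * (w.length + 1) := by
        rw [sz_pair]
        dsimp only
        nlinarith [Nat.zero_le (2 * k * w.length), Nat.zero_le (B (2 * k + 1) * w.length)]
      have h4 := Nat.pow_le_pow_left h3 c
      rw [mul_pow] at h4
      rw [add_mul]
      have h5 : 1 ≤ (w.length + 1) ^ c := Nat.one_le_pow _ _ (by omega)
      nlinarith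
    · rw [h]
      cases chk ((w, k), G k) <;> simp [enc_true, enc_false]

/-- The decision procedure, given the list of all guesses. -/
noncomputable def decideB (Γ : Language 2)
    (x : (List (Fin 2) × ℕ) × List (List (List ℕ))) : Bool :=
  -- Decoding is total, so malformed words are rejected by encoding the result again and comparing.
  decide (encRep (decRep (arities Γ) x.1.1) = x.1.1) && (validB (arities Γ) (decRep (arities Γ) x.1.1) &&
    (decide (x.1.2 = (decRep (arities Γ) x.1.1).2.1) &&
      x.2.any fun g => checkB (tables Γ) (decRep (arities Γ) x.1.1) g))

theorem fpt_of_weaklyZeroSeparable {Γ : Language 2} (hΓ : WeaklyZeroSeparable Γ) :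
    FPT (OneHotCSP Γ) := by
  refine FPT.of_advice (chk := decideB Γ) (G := guesses (arities Γ).sum) ?_ (ct_guesses _)
    fun x => ?_
  · unfold decideB
    fun_prop
  · rw [mem_oneHotCSP]
    simp only [decideB, Bool.and_eq_true, decide_eq_true_eq, validB_iff, List.any_eq_true]
    constructor
    · rintro ⟨r, hr, hs, rfl⟩
      simp only [decRep_encRep hr, true_and]
      exact ⟨hr, exists_guess hΓ hr hs⟩
    · rintro ⟨h1, h2, h3, g, -, hg⟩
      exact ⟨_, h2, repSat_of_checkB hΓ h2 hg, Prod.ext h1.symm h3⟩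

end

/-! ### Composition of reductions -/

/-- Depth of a tree. -/
def Data.depth : Data → ℕ
  | .nil => 0
  | .cons a b => max a.depth b.depth + 1

/-- Unlike the size, the depth grows by at most one per step. For strings and numbers it controls
the length and the value, so the output of a fast reduction is short even though subtrees are
shared. -/
theorem Run.depth_le {p : Prog} {x y : Data} {t : ℕ} (h : Run p x y t) :
    y.depth ≤ x.depth + t := by
  induction h with
  | skip | nil => simp [Data.depth]
  | hd x => cases x <;> simp [Data.depth, Data.hd]; omega
  | tl x => cases x <;> simp [Data.depth, Data.tl]; omega
  | cons _ _ ih₁ ih₂ => simp only [Data.depth]; omega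
  | _ => omega

theorem depth_nat (n : ℕ) : (enc n).depth = n := by
  induction n with
  | zero => rfl
  | succ n ih => rw [enc_succ, Data.depth, ih]; simp [Data.depth]

theorem depth_fin {s : ℕ} (a : Fin s) : (enc a).depth = a := depth_nat a

theorem length_le_depth {s : ℕ} (w : List (Fin s)) :
    w.length ≤ (enc w).depth ∧ (enc w).depth ≤ w.length + s := by
  induction w with
  | nil => simp [enc_nil, Data.depth]
  | cons a w ih =>
    have := a.2
    simp only [enc_cons, Data.depth, depth_fin, List.length_cons]
    omega

theorem W1Hard.of_pt {s : ℕ} {L : ParamProblem s}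
    {Q : List (Fin 2) × ℕ → List (Fin s) × ℕ} (hQ : PT Q)
    (h : ∀ x, x ∈ IndependentSet ↔ Q x ∈ L) (hp : ∀ x, (Q x).2 ≤ x.2 * x.2 + 1) : W1Hard L := by
  rintro s' L' ⟨P, hP, ⟨p, f, c, hf, hrun⟩, g, hg, hPg⟩
  obtain ⟨q, T, hq, ⟨e, hT⟩, -⟩ := hQ
  -- The intermediate instance has size at most a function of `k` times `(w.length + 1) ^ (c + 1)`,
  -- to which `q` applies a polynomial of degree `e`.
  refine ⟨fun x => Q (P x), fun x => (hP x).trans (h _), ⟨.seq p q,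
    fun k => f k + (6 * (s' + k + 2 + f k) + 5) ^ e + 1, c + (c + 1) * e, ?_, fun w k => ?_⟩,
    fun k => g k * g k + 1, computable_add (computable_mul hg hg) (Computable.const 1),
    fun w k => (hp _).trans ?_⟩
  · have hc : ∀ m : ℕ, Computable fun _ : ℕ => m := fun m => Computable.const m
    exact computable_add (computable_add hf (computable_pow (computable_add (computable_mul (hc 6)
      (computable_add (computable_add (computable_add (hc s') Computable.id) (hc 2)) hf)) (hc 5)) e))
      (hc 1)
  · obtain ⟨t, hr, ht⟩ := hrun w k
    obtain ⟨u, hu, hr'⟩ := hq (P (w, k))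
    refine ⟨t + u + 1, .seq hr (by rw [enc_input, enc_input]; exact hr'), ?_⟩
    have hd := hr.depth_le
    rw [enc_input, enc_input] at hd
    clear hr hr'
    generalize P (w, k) = y at hd hu
    obtain ⟨w', k'⟩ := y
    simp only [enc_pair, Data.depth, depth_nat] at hd
    have h1 := length_le_depth w
    have h2 := length_le_depth w'
    have h3 := sz_input_le w' k'
    have h4 := hT (w', k')
    set M := w.length + 1 with hM
    have hM1 : M ≤ M ^ (c + 1) := Nat.le_self_pow (by omega) M
    have hM2 : M ^ c ≤ M ^ (c + 1) := Nat.pow_le_pow_right (by omega) (by omega)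
    have h5 : sz (w', k') + 2 ≤ (6 * (s' + k + 2 + f k) + 5) * M ^ (c + 1) := by
      have h6 : sz (w', k') + 2 ≤ 6 * (M + (s' + k + 1) + t) + 5 := by omega
      have h7 : t ≤ f k * M ^ (c + 1) := ht.trans (Nat.mul_le_mul_left _ hM2)
      have h8 : 1 ≤ M ^ (c + 1) := Nat.one_le_pow _ _ (by omega)
      have h9 : s' + k + 1 ≤ (s' + k + 1) * M ^ (c + 1) := Nat.le_mul_of_pos_right _ h8
      calc sz (w', k') + 2 ≤ 6 * (M + (s' + k + 1) + t) + 5 := h6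
        _ ≤ 6 * (M ^ (c + 1) + (s' + k + 1) * M ^ (c + 1) + f k * M ^ (c + 1)) +
          5 * M ^ (c + 1) := by omega
        _ = _ := by ring
    have h6 := (hu.trans h4).trans (Nat.pow_le_pow_left h5 e)
    rw [mul_pow, ← pow_mul] at h6
    have h7 : M ^ c ≤ M ^ (c + (c + 1) * e) := Nat.pow_le_pow_right (by omega) (by omega)
    have h8 : M ^ ((c + 1) * e) ≤ M ^ (c + (c + 1) * e) :=
      Nat.pow_le_pow_right (by omega) (by omega)
    have h9 : 1 ≤ M ^ (c + (c + 1) * e) := Nat.one_le_pow _ _ (by omega)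
    have h10 := ht.trans (Nat.mul_le_mul_left (f k) h7)
    have h11 := h6.trans (Nat.mul_le_mul_left _ h8)
    rw [add_mul, add_mul, one_mul]
    omega
  · have := hPg w k
    exact Nat.add_le_add_right (Nat.mul_le_mul this this) 1

/-! ### Gadgets from languages that are not weakly 0-separable -/

/-- The list of truth values with a given pattern of four values. -/
def ev (pat : List ℕ) (a b c d : Bool) : List Bool :=
  pat.map fun m => if m = 0 then a else if m = 1 then b else if m = 2 then c else d

theorem ev_congr {pat : List ℕ} (h : 0 ∉ pat) (a a' b c d : Bool) :
    ev pat a b c d = ev pat a' b c d := by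
  refine List.map_congr_left fun m hm => ?_
  have : m ≠ 0 := fun h' => h (h' ▸ hm)
  simp [this]

/-- A relation that is not preserved has a counterexample whose first tuple is zero, or does not
contain the zero tuple. -/
theorem exists_violation {R : Rel 2} (h : ¬ (R.Preserves fNand ∧ R.Preserves gImpl)) :
    ∃ t₁ ∈ R.tuples, ∃ t₂ ∈ R.tuples, ∃ t₃ ∈ R.tuples, ∃ t ∉ R.tuples,
      ((∀ i, fNand (t₁ i) (t₂ i) (t₃ i) = some (t i)) ∨
        ∀ i, gImpl (t₁ i) (t₂ i) (t₃ i) = some (t i)) ∧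
      (t₁ = 0 ∨ 0 ∉ R.tuples) := by
  by_cases h0 : 0 ∈ R.tuples
  · by_contra! hno
    have hf : ∀ t₂ ∈ R.tuples, ∀ t₃ ∈ R.tuples, ∀ t,
        (∀ i, fNand 0 (t₂ i) (t₃ i) = some (t i)) → t ∈ R.tuples := by
      intro t₂ h₂ t₃ h₃ t ht
      by_contra h
      exact (hno 0 h0 t₂ h₂ t₃ h₃ t h (.inl ht)).1 rfl
    have hg : ∀ t₂ ∈ R.tuples, ∀ t₃ ∈ R.tuples, ∀ t,
        (∀ i, gImpl 0 (t₂ i) (t₃ i) = some (t i)) → t ∈ R.tuples := by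
      intro t₂ h₂ t₃ h₃ t ht
      by_contra h
      exact (hno 0 h0 t₂ h₂ t₃ h₃ t h (.inr ht)).1 rfl
    refine h ⟨fun t₁ h₁ t₂ h₂ t₃ h₃ t ht => ?_, fun t₁ h₁ t₂ h₂ t₃ h₃ t ht => ?_⟩
    -- With the zero tuple in `R`, replace the second tuple by its difference from the first one and
    -- the first tuple by zero.
    · have key : ∀ a b c d : Fin 2, fNand a b c = some d →
          gImpl 0 a b = some (if a = 0 then b else 0) ∧
            fNand 0 (if a = 0 then b else 0) c = some d := by decide
      exact hf _ (hg t₁ h₁ t₂ h₂ _ fun i => (key _ _ _ _ (ht i)).1) t₃ h₃ t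
        fun i => (key _ _ _ _ (ht i)).2
    · have key : ∀ a b c d : Fin 2, gImpl a b c = some d →
          gImpl 0 a b = some (if a = 0 then b else 0) ∧
            gImpl 0 (if a = 0 then b else 0) c = some d := by decide
      exact hg _ (hg t₁ h₁ t₂ h₂ _ fun i => (key _ _ _ _ (ht i)).1) t₃ h₃ t
        fun i => (key _ _ _ _ (ht i)).2
  · simp only [Rel.Preserves] at h
    rw [not_and_or] at h
    push Not at h
    rcases h with ⟨t₁, h₁, t₂, h₂, t₃, h₃, t, ht, h⟩ | ⟨t₁, h₁, t₂, h₂, t₃, h₃, t, ht, h⟩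
    · exact ⟨t₁, h₁, t₂, h₂, t₃, h₃, t, h, .inl ht, .inr h0⟩
    · exact ⟨t₁, h₁, t₂, h₂, t₃, h₃, t, h, .inr ht, .inr h0⟩

/-- The relation with position `ρ`, with its arguments identified according to the pattern `pat`,
excludes a single combination of the arguments `1` and `2`, if the arguments `0` and `3` are one
and zero. -/
def IsGadget (Γ : Language 2) (ρ : ℕ) (pat : List ℕ) (nd : Bool) : Prop :=
  ρ < (arities Γ).length ∧ pat.length = (arities Γ).getD ρ 0 ∧
    (∀ b c, ev pat true b c false ∈ (tables Γ).getD ρ [] ↔ ¬ (b = true ∧ c = nd)) ∧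
    -- A constant one can be enforced when the zero tuple is excluded; otherwise the pattern must do
    -- without it.
    (0 ∈ pat → ev pat false false false false ∉ (tables Γ).getD ρ [])

/-- Coordinates are identified when they have the same column in the three tuples of a violation.
The four values of the two free arguments then produce exactly these tuples and the missing one. -/
theorem exists_isGadget {Γ : Language 2} (h : ¬ WeaklyZeroSeparable Γ) :
    ∃ ρ pat nd, IsGadget Γ ρ pat nd := by
  simp only [WeaklyZeroSeparable, not_forall] at h
  obtain ⟨R, hR, h⟩ := h
  obtain ⟨ρ, hρ, rfl⟩ := List.getElem_of_mem hR
  obtain ⟨t₁, h₁, t₂, h₂, t₃, h₃, t, ht, h, h0⟩ := exists_violation h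
  have htb : (tables Γ).getD ρ [] = tupList Γ[ρ] := by simp [tables, hρ]
  have key : ∀ (code : Fin Γ[ρ].arity → ℕ) (a b c d : Bool) (u : Fin Γ[ρ].arity → Fin 2),
      (∀ i, (if code i = 0 then a else if code i = 1 then b else if code i = 2 then c else d) =
        decide (u i = 1)) → ev (List.ofFn code) a b c d = tupBits u := by
    intro code a b c d u hu
    simp only [ev, tupBits, List.map_ofFn, Function.comp_def, hu]
  have hz : (0 : Fin Γ[ρ].arity → Fin 2) ∉ Γ[ρ].tuples ∨ ∀ i, t₁ i = 0 := by
    rcases h0 with h0 | h0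
    · exact .inr fun i => congrFun h0 i
    · exact .inl h0
  have hz0 : ∀ code : Fin Γ[ρ].arity → ℕ, (∀ i, code i = 0 → t₁ i = 1) →
      (0 ∈ List.ofFn code → ev (List.ofFn code) false false false false ∉ (tables Γ).getD ρ []) := by
    intro code hcode hmem
    rw [key code _ _ _ _ 0 (fun i => by simp), htb, mem_tupList]
    refine hz.resolve_right fun h => ?_
    obtain ⟨i, hi⟩ := (List.mem_ofFn' _ _).1 hmem
    have := hcode i hi
    rw [h i] at this
    exact absurd this (by decide)
  rcases h with h | h
  -- Both false gives `t₁`, only the first true gives `t₂`, only the second gives `t₃`, and both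
  -- true gives the missing tuple.
  · have hk : ∀ x y z w : Fin 2, fNand x y z = some w →
        ((if x = 1 then 0 else if y = 1 then 1 else if z = 1 then 2 else 3 : ℕ) = 0 → x = 1) ∧
        ∀ b c : Bool, (if (if x = 1 then 0 else if y = 1 then 1 else if z = 1 then 2 else 3) = 0
          then true else if (if x = 1 then 0 else if y = 1 then 1 else if z = 1 then 2 else 3) = 1
          then b else if (if x = 1 then 0 else if y = 1 then 1 else if z = 1 then 2 else 3) = 2
          then c else false) = decide ((bif b then bif c then w else y else bif c then z else x) = 1) := by
      decide
    refine ⟨ρ, List.ofFn fun i => if t₁ i = 1 then 0 else if t₂ i = 1 then 1 else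
      if t₃ i = 1 then 2 else 3, true, by simpa [arities], by simp [arities, hρ], fun b c => ?_,
      hz0 _ fun i => (hk _ _ _ _ (h i)).1⟩
    rw [key _ _ _ _ _ _ fun i => (hk _ _ _ _ (h i)).2 b c, htb, mem_tupList]
    cases b <;> cases c <;> simp [h₁, h₂, h₃, ht]
  -- Here both false gives `t₁`, only the second true gives `t₂`, both true gives `t₃`, and only the
  -- first true gives the missing tuple.
  · have hk : ∀ x y z w : Fin 2, gImpl x y z = some w →
        ((if x = 1 then 0 else if y = 1 then 2 else if z = 1 then 1 else 3 : ℕ) = 0 → x = 1) ∧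
        ∀ b c : Bool, (if (if x = 1 then 0 else if y = 1 then 2 else if z = 1 then 1 else 3) = 0
          then true else if (if x = 1 then 0 else if y = 1 then 2 else if z = 1 then 1 else 3) = 1
          then b else if (if x = 1 then 0 else if y = 1 then 2 else if z = 1 then 1 else 3) = 2
          then c else false) = decide ((bif b then bif c then z else w else bif c then y else x) = 1) := by
      decide
    refine ⟨ρ, List.ofFn fun i => if t₁ i = 1 then 0 else if t₂ i = 1 then 2 else
      if t₃ i = 1 then 1 else 3, false, by simpa [arities], by simp [arities, hρ], fun b c => ?_,
      hz0 _ fun i => (hk _ _ _ _ (h i)).1⟩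
    rw [key _ _ _ _ _ _ fun i => (hk _ _ _ _ (h i)).2 b c, htb, mem_tupList]
    cases b <;> cases c <;> simp [h₁, h₂, h₃, ht]

/-! ### The reduction from Independent Set -/

/-- Two constraints that enforce a basic constraint on the arguments `p` and `q`. -/
def gadget (ρ : ℕ) (pat : List ℕ) (z : ℕ) (p q : ℕ × ℕ) : List Con :=
  -- The pair `(z, d)` plays the constant zero. Whatever value `z` takes, at least one of the two
  -- choices of `d` makes it false.
  [1, 2].map fun d => (ρ, pat.map fun m => bif decide (m = 0) then (z, 0) else
    bif decide (m = 1) then p else bif decide (m = 2) then q else (z, d))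

/-- Two constraints that make sure that `gadget` can be used. -/
def zeroGadget (ρ : ℕ) (pat : List ℕ) (z : ℕ) : List Con :=
  [1, 2].map fun d => (ρ, pat.map fun m => bif decide (m = 0) then (z, 0) else (z, d))

/-- Basic constraints that enforce the implication from `p` to `q`. -/
def expand (nd : Bool) (N : ℕ) (p q : ℕ × ℕ) : List ((ℕ × ℕ) × (ℕ × ℕ)) :=
  bif nd then ((List.range N).filter fun b => !decide (b = q.2)).map fun b => (p, (q.1, b))
  else [(p, q)]

/-- Constraints that enforce a list of implications. -/
def implCons (ρ : ℕ) (pat : List ℕ) (nd : Bool) (z N : ℕ) (l : List ((ℕ × ℕ) × (ℕ × ℕ))) :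
    List Con :=
  zeroGadget ρ pat z ++
    l.flatMap fun e => (expand nd N e.1 e.2).flatMap fun e' => gadget ρ pat z e'.1 e'.2

theorem satBy_implCons_iff {Γ : Language 2} {ρ : ℕ} {pat : List ℕ} {nd : Bool}
    {z N : ℕ} {l : List ((ℕ × ℕ) × (ℕ × ℕ))} {f : ℕ → ℕ} :
    SatBy (tables Γ) (implCons ρ pat nd z N l) (fun p => f p.1 = p.2) ↔
      (∀ d ∈ [1, 2], ev pat (f z = 0) (f z = d) (f z = d) (f z = d) ∈ (tables Γ).getD ρ []) ∧
      ∀ e ∈ l, ∀ e' ∈ expand nd N e.1 e.2, ∀ d ∈ [1, 2],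
        ev pat (f z = 0) (f e'.1.1 = e'.1.2) (f e'.2.1 = e'.2.2) (f z = d) ∈
          (tables Γ).getD ρ [] := by
  have h1 : ∀ z d, (pat.map fun m => bif decide (m = 0) then (z, 0) else (z, d)).map
      (fun p : ℕ × ℕ => decide (f p.1 = p.2)) =
      ev pat (f z = 0) (f z = d) (f z = d) (f z = d) := by
    intro z d
    rw [ev, List.map_map]
    refine List.map_congr_left fun m _ => ?_
    by_cases h0 : m = 0 <;> simp [h0]
  have h2 : ∀ z d p q, (pat.map fun m => bif decide (m = 0) then (z, 0) else
      bif decide (m = 1) then p else bif decide (m = 2) then q else (z, d)).map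
      (fun p : ℕ × ℕ => decide (f p.1 = p.2)) =
      ev pat (f z = 0) (f p.1 = p.2) (f q.1 = q.2) (f z = d) := by
    intro z d p q
    rw [ev, List.map_map]
    refine List.map_congr_left fun m _ => ?_
    by_cases h0 : m = 0
    · simp [h0]
    · by_cases h1 : m = 1
      · simp [h1]
      · by_cases h2 : m = 2 <;> simp [h0, h1, h2]
  simp only [SatBy, implCons, zeroGadget, gadget, List.mem_append, List.mem_flatMap, List.mem_map,
    or_imp, forall_and, forall_exists_index, and_imp]
  constructor
  · rintro ⟨ha, hb⟩
    refine ⟨fun d hd => ?_, fun e he e' he' d hd => ?_⟩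
    · rw [← h1]; exact ha _ d hd rfl
    · rw [← h2]; exact hb _ e he e' he' d hd rfl
  · rintro ⟨ha, hb⟩
    refine ⟨?_, ?_⟩
    · rintro _ d hd rfl
      rw [h1]; exact ha d hd
    · rintro _ e he e' he' d hd rfl
      rw [h2]; exact hb e he e' he' d hd

/-- Choose `d` different from the value of `z`. If the constant one occurs in the pattern, then `z`
must be `0`, since otherwise `zeroGadget` would put the zero tuple into the relation. If it does not
occur, the value of `z = 0` is irrelevant by `ev_congr`. -/
theorem impl_of_satBy {Γ : Language 2} {ρ : ℕ} {pat : List ℕ} {nd : Bool}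
    (h : IsGadget Γ ρ pat nd) {z N : ℕ} {l : List ((ℕ × ℕ) × (ℕ × ℕ))} {f : ℕ → ℕ}
    (hs : SatBy (tables Γ) (implCons ρ pat nd z N l) fun p => f p.1 = p.2) {p q : ℕ × ℕ}
    (he : (p, q) ∈ l) (hq : f q.1 < N) (hp : f p.1 = p.2) : f q.1 = q.2 := by
  obtain ⟨h0, hs⟩ := satBy_implCons_iff.1 hs
  obtain ⟨d, hd, hd'⟩ : ∃ d ∈ [1, 2], f z ≠ d := by
    by_cases h1 : f z = 1
    · exact ⟨2, by simp, by omega⟩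
    · exact ⟨1, by simp, h1⟩
  have key : ∀ b c, ev pat (decide (f z = 0)) b c (decide (f z = d)) ∈ (tables Γ).getD ρ [] →
      ¬ (b = true ∧ c = nd) := by
    intro b c hbc
    rw [decide_eq_false hd'] at hbc
    by_cases hz : f z = 0
    · rw [decide_eq_true hz, h.2.2.1] at hbc
      exact hbc
    · have h0' : 0 ∉ pat := by
        intro hmem
        have := h0 d hd
        rw [decide_eq_false hd', decide_eq_false hz] at this
        exact h.2.2.2 hmem this
      rw [ev_congr h0' _ true, h.2.2.1] at hbc
      exact hbc
  by_contra hne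
  cases nd with
  | false => exact key _ _ (hs _ he (p, q) (by simp [expand]) d hd) ⟨by simpa using hp, by simpa using hne⟩
  | true =>
    refine key _ _ (hs _ he (p, (q.1, f q.1)) ?_ d hd) ⟨by simpa using hp, by simp⟩
    simp [expand, hq, hne]

theorem satBy_of_impl {Γ : Language 2} {ρ : ℕ} {pat : List ℕ} {nd : Bool}
    (h : IsGadget Γ ρ pat nd) {z N : ℕ} {l : List ((ℕ × ℕ) × (ℕ × ℕ))} {f : ℕ → ℕ}
    (hz : f z = 0) (hl : ∀ e ∈ l, f e.1.1 = e.1.2 → f e.2.1 = e.2.2) :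
    SatBy (tables Γ) (implCons ρ pat nd z N l) fun p => f p.1 = p.2 := by
  rw [satBy_implCons_iff]
  have hd : ∀ d ∈ [1, 2], decide (f z = d) = false := by simp [hz]
  rw [decide_eq_true hz]
  refine ⟨fun d hd' => ?_, fun e he e' he' d hd' => ?_⟩
  · rw [hd d hd', h.2.2.1]
    simp
  · rw [hd d hd', h.2.2.1]
    rintro ⟨h1, h2⟩
    cases nd with
    | false =>
      obtain rfl : e' = (e.1, e.2) := by simpa [expand] using he'
      have := hl e he (by simpa using h1)
      simp [this] at h2
    | true =>
      simp only [expand, cond_true, List.mem_map, List.mem_filter] at he'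
      obtain ⟨b, ⟨-, hb⟩, rfl⟩ := he'
      have := hl e he (by simpa using h1)
      simp only [decide_eq_true_eq] at h2
      simp only [Bool.not_eq_true', decide_eq_false_iff_not] at hb
      omega

/-- Whether `u`, `v` may be the vertices with numbers `i`, `j` of an independent set. -/
def allowed (n : ℕ) (ed : List (ℕ × ℕ)) (i j u v : ℕ) : Bool :=
  decide (u < n) && (decide (v < n) && bif decide (i = j) then decide (u = v) else
    !decide (u = v) && !(decide ((u, v) ∈ ed) || decide ((v, u) ∈ ed)))

/-- Implications between `[y_{i,j} = (u, v)]`, for variables `y_{i,j}`, that express that there is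
an independent set. -/
def indepImpl (n k : ℕ) (ed : List (ℕ × ℕ)) : List ((ℕ × ℕ) × (ℕ × ℕ)) :=
  (List.range k).flatMap fun i => (List.range k).flatMap fun j =>
    (List.range (n + 2)).flatMap fun u => (List.range (n + 2)).flatMap fun v =>
      bif allowed n ed i j u v then
        [((i * k + j, u * (n + 2) + v), (i * k + i, u * (n + 2) + u)),
          ((i * k + j, u * (n + 2) + v), (j * k + j, v * (n + 2) + v))]
      else
        -- A forbidden value implies two different values of the same variable, so it cannot be
        -- taken. Using `n + 2` instead of `n` ensures that the domain contains `0`, `1`, `2` even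
        -- without vertices; the two spare indices are never allowed.
        [((i * k + j, u * (n + 2) + v), (i * k + j, 0)),
          ((i * k + j, u * (n + 2) + v), (i * k + j, 1))]

theorem mem_indepImpl {n k : ℕ} {ed : List (ℕ × ℕ)} {e : (ℕ × ℕ) × (ℕ × ℕ)} :
    e ∈ indepImpl n k ed ↔ ∃ i < k, ∃ j < k, ∃ u < n + 2, ∃ v < n + 2,
      (e.1 = (i * k + j, u * (n + 2) + v)) ∧
        ((allowed n ed i j u v = true ∧ (e.2 = (i * k + i, u * (n + 2) + u) ∨
          e.2 = (j * k + j, v * (n + 2) + v))) ∨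
        (allowed n ed i j u v = false ∧ (e.2 = (i * k + j, 0) ∨ e.2 = (i * k + j, 1)))) := by
  simp only [indepImpl, List.mem_flatMap, List.mem_range]
  refine exists_congr fun i => and_congr_right fun _ => exists_congr fun j =>
    and_congr_right fun _ => exists_congr fun u => and_congr_right fun _ => exists_congr fun v =>
    and_congr_right fun _ => ?_
  obtain ⟨e₁, e₂⟩ := e
  cases allowed n ed i j u v <;> simp <;> tauto

theorem pair_lt {i j k : ℕ} (hi : i < k) (hj : j < k) : i * k + j < k * k := by nlinarith

theorem pair_div {i j k : ℕ} (hj : j < k) : (i * k + j) / k = i := by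
  rw [mul_comm, Nat.mul_add_div (by omega), Nat.div_eq_of_lt hj, add_zero]

theorem pair_mod {i j k : ℕ} (hj : j < k) : (i * k + j) % k = j := by
  rw [mul_comm, Nat.mul_add_mod, Nat.mod_eq_of_lt hj]

theorem pair_inj {i j i' j' k : ℕ} (hj : j < k) (hj' : j' < k) (h : i * k + j = i' * k + j') :
    i = i' ∧ j = j' := by
  have h1 := pair_div (i := i) hj
  have h2 := pair_mod (i := i) hj
  rw [h, pair_div hj'] at h1
  rw [h, pair_mod hj'] at h2
  exact ⟨h1.symm, h2.symm⟩

/-- There are `k` distinct pairwise non-adjacent vertices. -/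
def HasIndep (n k : ℕ) (ed : List (ℕ × ℕ)) : Prop :=
  ∃ x : ℕ → ℕ, (∀ i < k, x i < n) ∧ ∀ i < k, ∀ j < k, i ≠ j →
    x i ≠ x j ∧ ¬ ((x i, x j) ∈ ed ∨ (x j, x i) ∈ ed)

/-- The instance of One-Hot-CSP. -/
def indepRep (ρ : ℕ) (pat : List ℕ) (nd : Bool) (n k : ℕ) (ed : List (ℕ × ℕ)) : Rep :=
  ((n + 2) * (n + 2), k * k + 1,
    implCons ρ pat nd (k * k) ((n + 2) * (n + 2)) (indepImpl n k ed))

/-- The diagonal variable `y_{i,i}` names the `i`-th vertex. Each `y_{i,j}` takes an allowed pair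
and transmits its components to the diagonal, so any two chosen vertices are distinct and
non-adjacent. -/
theorem repSat_indepRep {Γ : Language 2} {ρ : ℕ} {pat : List ℕ} {nd : Bool}
    (h : IsGadget Γ ρ pat nd) {n k : ℕ} {ed : List (ℕ × ℕ)} :
    RepSat (tables Γ) (indepRep ρ pat nd n k ed) ↔ HasIndep n k ed := by
  constructor
  · rintro ⟨f, hf, hs⟩
    simp only [indepRep] at hf hs
    have himp : ∀ p q, (p, q) ∈ indepImpl n k ed → q.1 < k * k + 1 → f p.1 = p.2 → f q.1 = q.2 :=
      fun p q hpq hq => impl_of_satBy h hs hpq (hf _ hq)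
    have key : ∀ i < k, ∀ j < k, ∃ u < n, ∃ v < n, f (i * k + i) = u * (n + 2) + u ∧
        f (j * k + j) = v * (n + 2) + v ∧ allowed n ed i j u v = true := by
      intro i hi j hj
      have hlt := pair_lt hi hj
      have hN := hf (i * k + j) (by omega)
      set u := f (i * k + j) / (n + 2)
      set v := f (i * k + j) % (n + 2)
      have hu : u < n + 2 := Nat.div_lt_of_lt_mul hN
      have hv : v < n + 2 := Nat.mod_lt _ (by omega)
      have huv : f (i * k + j) = u * (n + 2) + v := (Nat.div_add_mod' _ _).symm
      cases hal : allowed n ed i j u v with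
      | false =>
        have h0 := himp (i * k + j, u * (n + 2) + v) (i * k + j, 0)
          (mem_indepImpl.2 ⟨i, hi, j, hj, u, hu, v, hv, rfl, .inr ⟨hal, .inl rfl⟩⟩)
          (by dsimp only; omega) huv
        have h1 := himp (i * k + j, u * (n + 2) + v) (i * k + j, 1)
          (mem_indepImpl.2 ⟨i, hi, j, hj, u, hu, v, hv, rfl, .inr ⟨hal, .inr rfl⟩⟩)
          (by dsimp only; omega) huv
        simp only at h0 h1
        omega
      | true =>
        have h0 := himp (i * k + j, u * (n + 2) + v) (i * k + i, u * (n + 2) + u)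
          (mem_indepImpl.2 ⟨i, hi, j, hj, u, hu, v, hv, rfl, .inl ⟨hal, .inl rfl⟩⟩)
          (by have := pair_lt hi hi; dsimp only; omega) huv
        have h1 := himp (i * k + j, u * (n + 2) + v) (j * k + j, v * (n + 2) + v)
          (mem_indepImpl.2 ⟨i, hi, j, hj, u, hu, v, hv, rfl, .inl ⟨hal, .inr rfl⟩⟩)
          (by have := pair_lt hj hj; dsimp only; omega) huv
        have hal' := hal
        simp only [allowed, Bool.and_eq_true, decide_eq_true_eq] at hal'
        exact ⟨u, hal'.1, v, hal'.2.1, h0, h1, hal⟩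
    refine ⟨fun i => f (i * k + i) / (n + 2), fun i hi => ?_, fun i hi j hj hij => ?_⟩
    · obtain ⟨u, hu, -, -, h1, -, -⟩ := key i hi i hi
      dsimp only
      rw [h1, pair_div (by omega)]
      exact hu
    · obtain ⟨u, hu, v, hv, h1, h2, h3⟩ := key i hi j hj
      dsimp only
      rw [h1, h2, pair_div (by omega), pair_div (by omega)]
      simp only [allowed, decide_eq_false hij, cond_false, Bool.and_eq_true,
        Bool.not_eq_true', Bool.or_eq_false_iff, decide_eq_false_iff_not] at h3
      exact ⟨h3.2.2.1, not_or.2 h3.2.2.2⟩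
  · rintro ⟨x, hx, hx'⟩
    obtain ⟨f, hf⟩ : ∃ f : ℕ → ℕ,
        -- The variable `k * k` is the auxiliary `z`; the value `0` makes the simulated constants
        -- correct.
        f = fun m => if m = k * k then 0 else x (m / k) * (n + 2) + x (m % k) := ⟨_, rfl⟩
    have hfv : ∀ i < k, ∀ j < k, f (i * k + j) = x i * (n + 2) + x j := by
      intro i hi j hj
      have := pair_lt hi hj
      simp only [hf]
      rw [if_neg (by omega), pair_div hj, pair_mod hj]
    have hfb : ∀ m < k * k + 1, f m < (n + 2) * (n + 2) := by
      intro m hm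
      simp only [hf]
      split_ifs with h
      · positivity
      · have hk : 0 < k := Nat.pos_of_ne_zero fun h0 => by subst h0; omega
        have h1 := hx (m / k) (Nat.div_lt_of_lt_mul (by omega))
        have h2 := hx (m % k) (Nat.mod_lt _ hk)
        exact pair_lt (by omega) (by omega)
    refine ⟨f, hfb, ?_⟩
    · refine satBy_of_impl h (by simp [hf]) fun e he => ?_
      obtain ⟨i, hi, j, hj, u, hu, v, hv, he1, he2⟩ := mem_indepImpl.1 he
      rw [he1]
      dsimp only
      rw [hfv i hi j hj]
      intro heq
      have hxi := hx i hi
      have hxj := hx j hj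
      obtain ⟨rfl, rfl⟩ := pair_inj (by omega) hv heq
      rcases he2 with ⟨-, he2 | he2⟩ | ⟨hal, -⟩
      · rw [he2]; exact hfv i hi i hi
      · rw [he2]; exact hfv j hj j hj
      · exfalso
        by_cases hij : i = j
        · subst hij
          simp [allowed, hxi] at hal
        · obtain ⟨h1, h2⟩ := hx' i hi j hj hij
          rw [not_or] at h2
          simp [allowed, hxi, hxj, hij, h1, h2.1, h2.2] at hal

theorem validRep_indepRep {Γ : Language 2} {ρ : ℕ} {pat : List ℕ} {nd : Bool}
    (h : IsGadget Γ ρ pat nd) (n k : ℕ) (ed : List (ℕ × ℕ)) :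
    ValidRep (arities Γ) (indepRep ρ pat nd n k ed) := by
  have h4 : 4 ≤ (n + 2) * (n + 2) := by nlinarith
  have himp : ∀ e ∈ indepImpl n k ed, (e.1.1 < k * k + 1 ∧ e.1.2 < (n + 2) * (n + 2)) ∧
      (e.2.1 < k * k + 1 ∧ e.2.2 < (n + 2) * (n + 2)) := by
    intro e he
    obtain ⟨i, hi, j, hj, u, hu, v, hv, he1, he2⟩ := mem_indepImpl.1 he
    have h1 := pair_lt hi hj
    have h2 := pair_lt hi hi
    have h3 := pair_lt hj hj
    have h5 := pair_lt hu hv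
    have h6 := pair_lt hu hu
    have h7 := pair_lt hv hv
    rw [he1]
    rcases he2 with ⟨-, he2 | he2⟩ | ⟨-, he2 | he2⟩ <;> rw [he2] <;> dsimp only <;> omega
  intro c hc
  simp only [indepRep, implCons, List.mem_append, List.mem_flatMap] at hc
  rcases hc with hc | ⟨e, he, e', he', hc⟩
  · obtain ⟨d, hd, rfl⟩ := List.mem_map.1 hc
    refine ⟨h.1, by simpa using h.2.1, fun p hp => ?_⟩
    obtain ⟨m, -, rfl⟩ := List.mem_map.1 hp
    have hd' : d = 1 ∨ d = 2 := by simpa using hd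
    simp only [indepRep]
    cases decide (m = 0) <;> simp only [cond_true, cond_false] <;> omega
  · obtain ⟨d, hd, rfl⟩ := List.mem_map.1 hc
    refine ⟨h.1, by simpa using h.2.1, fun p hp => ?_⟩
    obtain ⟨m, -, rfl⟩ := List.mem_map.1 hp
    have hd' : d = 1 ∨ d = 2 := by simpa using hd
    obtain ⟨h1, h2⟩ := himp e he
    have h3 : (e'.1.1 < k * k + 1 ∧ e'.1.2 < (n + 2) * (n + 2)) ∧
      (e'.2.1 < k * k + 1 ∧ e'.2.2 < (n + 2) * (n + 2)) := by
      cases nd with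
      | false =>
        obtain rfl : e' = (e.1, e.2) := by simpa [expand] using he'
        exact ⟨h1, h2⟩
      | true =>
        simp only [expand, cond_true, List.mem_map, List.mem_filter, List.mem_range] at he'
        obtain ⟨b, ⟨hb, -⟩, rfl⟩ := he'
        exact ⟨h1, h2.1, hb⟩
    simp only [indepRep]
    cases decide (m = 0)
    · cases decide (m = 1)
      · cases decide (m = 2)
        · simp only [cond_false]; omega
        · exact h3.2
      · exact h3.1
    · simp only [cond_true]; omega

/-- The numbers that encode a graph. -/
def graphNums (n : ℕ) (ed : List (ℕ × ℕ)) : List ℕ := n :: ed.flatMap fun e => [e.1, e.2]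

/-- All edges join two different vertices. -/
def ValidEdges (n : ℕ) (ed : List (ℕ × ℕ)) : Prop := ∀ e ∈ ed, e.1 < n ∧ e.2 < n ∧ e.1 ≠ e.2

/-- Replaces graphs by edge lists and vertex sets by enumerations; `ValidEdges` excludes loops,
which accounts for irreflexivity. -/
theorem mem_independentSet {x : List (Fin 2) × ℕ} : x ∈ IndependentSet ↔ 1 ≤ x.2 ∧
    ∃ n ed, x.1 = unaryCode (graphNums n ed) ∧ ValidEdges n ed ∧ HasIndep n x.2 ed := by
  obtain ⟨w, k⟩ := x
  refine and_congr_right fun _ => exists_congr fun n => ?_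
  constructor
  · rintro ⟨G, ⟨E, hw, hE⟩, S, hS⟩
    have hmem : ∀ a b : Fin n, ((a : ℕ), (b : ℕ)) ∈
        E.map (fun e => ((e.1 : ℕ), (e.2 : ℕ))) ↔ (a, b) ∈ E := by
      intro a b
      simp only [List.mem_map, Prod.mk.injEq, Fin.val_inj]
      constructor
      · rintro ⟨e, he, rfl, rfl⟩; exact he
      · exact fun h => ⟨_, h, rfl, rfl⟩
    refine ⟨E.map fun e => (e.1, e.2), ?_, ?_, ?_⟩
    · rw [hw, graphNums, List.flatMap_map]
    · intro e he
      obtain ⟨⟨a, b⟩, hab, rfl⟩ := List.mem_map.1 he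
      refine ⟨a.2, b.2, fun h => ?_⟩
      obtain rfl : a = b := Fin.ext h
      exact G.irrefl ((hE a a).2 (.inl hab))
    · let x : Fin k → Fin n := fun i => (S.equivFinOfCardEq hS.card_eq).symm i
      have hx : Function.Injective x :=
        Subtype.val_injective.comp (S.equivFinOfCardEq hS.card_eq).symm.injective
      refine ⟨fun i => if h : i < k then x ⟨i, h⟩ else 0, fun i hi => by simp [hi],
        fun i hi j hj hij => ?_⟩
      have hne : x ⟨i, hi⟩ ≠ x ⟨j, hj⟩ := fun h => hij (by simpa using hx h)
      have hadj : ¬ G.Adj (x ⟨i, hi⟩) (x ⟨j, hj⟩) := hS.isIndepSet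
        (Subtype.prop _ : x ⟨i, hi⟩ ∈ S) (Subtype.prop _ : x ⟨j, hj⟩ ∈ S) hne
      rw [hE] at hadj
      simp only [dif_pos hi, dif_pos hj, hmem]
      exact ⟨fun h => hne (Fin.ext h), hadj⟩
  · rintro ⟨ed, hw, hv, x, hx, hx'⟩
    have hE : ∃ E : List (Fin n × Fin n), E.map (fun e => ((e.1 : ℕ), (e.2 : ℕ))) = ed := by
      clear hx' hw
      induction ed with
      | nil => exact ⟨[], rfl⟩
      | cons e ed ih =>
        obtain ⟨E, rfl⟩ := ih fun e he => hv e (by simp [he])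
        obtain ⟨h1, h2, -⟩ := hv e (by simp)
        exact ⟨(⟨e.1, h1⟩, ⟨e.2, h2⟩) :: E, rfl⟩
    obtain ⟨E, rfl⟩ := hE
    have hmem : ∀ a b : Fin n, ((a : ℕ), (b : ℕ)) ∈
        E.map (fun e => ((e.1 : ℕ), (e.2 : ℕ))) ↔ (a, b) ∈ E := by
      intro a b
      simp only [List.mem_map, Prod.mk.injEq, Fin.val_inj]
      constructor
      · rintro ⟨e, he, rfl, rfl⟩; exact he
      · exact fun h => ⟨_, h, rfl, rfl⟩
    let G : SimpleGraph (Fin n) :=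
      { Adj := fun a b => (a, b) ∈ E ∨ (b, a) ∈ E
        symm := ⟨fun a b h => h.symm⟩
        loopless := ⟨fun a h => (hv _ ((hmem a a).2 (h.elim id id))).2.2 rfl⟩ }
    have hinj : Function.Injective fun i : Fin k => (⟨x i, hx i i.2⟩ : Fin n) := by
      intro i j h
      by_contra hij
      exact (hx' i i.2 j j.2 fun h => hij (Fin.ext h)).1 (Fin.mk.inj_iff.1 h)
    refine ⟨G, ⟨E, by rw [hw, graphNums, List.flatMap_map], fun a b => Iff.rfl⟩,
      Finset.univ.image fun i : Fin k => ⟨x i, hx i i.2⟩, ?_, ?_⟩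
    · intro a ha b hb hab
      simp only [Finset.coe_image, Finset.coe_univ, Set.image_univ, Set.mem_range] at ha hb
      obtain ⟨i, rfl⟩ := ha
      obtain ⟨j, rfl⟩ := hb
      have := (hx' i i.2 j j.2 fun h => hab (by rw [Fin.ext h])).2
      have h1 := hmem ⟨x i, hx i i.2⟩ ⟨x j, hx j j.2⟩
      have h2 := hmem ⟨x j, hx j j.2⟩ ⟨x i, hx i i.2⟩
      exact fun h => this (h.imp h1.2 h2.2)
    · rw [Finset.card_image_of_injective _ hinj, Finset.card_univ, Fintype.card_fin]

/-- Inverse of `graphNums`. -/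
def decEdges (l : List ℕ) : List (ℕ × ℕ) :=
  (rests (fun l => l.drop 2) l.tail).map fun l => (l.headD 0, l.getD 1 0)

theorem decEdges_graphNums (n : ℕ) (ed : List (ℕ × ℕ)) : decEdges (graphNums n ed) = ed :=
  map_rests_flatMap _ _ _ _ rfl fun e _ l => ⟨by simp, rfl, rfl⟩

/-- The reduction from Independent Set to One-Hot-CSP. -/
def reduction (ρ : ℕ) (pat : List ℕ) (nd : Bool) (x : List (Fin 2) × ℕ) : List (Fin 2) × ℕ :=
  bif decide (x.1 = unaryCode (graphNums ((decodeNums x.1).headD 0) (decEdges (decodeNums x.1)))) &&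
    (decide (1 ≤ x.2) && (decEdges (decodeNums x.1)).all fun e =>
      decide (e.1 < (decodeNums x.1).headD 0) &&
        (decide (e.2 < (decodeNums x.1).headD 0) && !decide (e.1 = e.2)))
  then (encRep (indepRep ρ pat nd ((decodeNums x.1).headD 0) x.2 (decEdges (decodeNums x.1))),
    x.2 * x.2 + 1)
  -- A no-instance: the code of any instance contains at least the domain size and the number of
  -- variables, so it is nonempty.
  else ([], 0)

section
variable {γ : Type} [Enc γ]

@[fun_prop]
theorem pt_decEdges {l : γ → List ℕ} (hl : PT l) : PT (fun x => decEdges (l x)) := by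
  have : PT (fun x => rests (fun l => l.drop 2) (l x).tail) :=
    pt_rests (step := fun _ l => l.drop 2) (by fun_prop) (by fun_prop) fun _ _ => sz_drop_le _ _
  unfold decEdges
  fun_prop

@[fun_prop]
theorem pt_indepImpl {n k : γ → ℕ} {ed : γ → List (ℕ × ℕ)} (hn : PT n) (hk : PT k) (he : PT ed) :
    PT (fun x => indepImpl (n x) (k x) (ed x)) := by
  unfold indepImpl allowed
  fun_prop

@[fun_prop]
theorem pt_implCons (ρ : ℕ) (pat : List ℕ) (nd : Bool) {z N : γ → ℕ}
    {l : γ → List ((ℕ × ℕ) × (ℕ × ℕ))} (hz : PT z) (hN : PT N) (hl : PT l) :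
    PT (fun x => implCons ρ pat nd (z x) (N x) (l x)) := by
  unfold implCons gadget zeroGadget expand
  fun_prop

theorem pt_reduction (ρ : ℕ) (pat : List ℕ) (nd : Bool) : PT (reduction ρ pat nd) := by
  unfold reduction graphNums indepRep
  fun_prop

end

theorem w1Hard_of_not_weaklyZeroSeparable {Γ : Language 2} (h : ¬ WeaklyZeroSeparable Γ) :
    W1Hard (OneHotCSP Γ) := by
  obtain ⟨ρ, pat, nd, hg⟩ := exists_isGadget h
  refine W1Hard.of_pt (pt_reduction ρ pat nd) (fun x => ?_) fun x => ?_
  · rw [mem_independentSet, mem_oneHotCSP]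
    constructor
    · rintro ⟨hk, n, ed, hw, hv, hi⟩
      have h1 : (decodeNums x.1).headD 0 = n := by rw [hw, decodeNums_unaryCode]; rfl
      have h2 : decEdges (decodeNums x.1) = ed := by
        rw [hw, decodeNums_unaryCode, decEdges_graphNums]
      refine ⟨_, validRep_indepRep hg n x.2 ed, (repSat_indepRep hg).2 hi, ?_⟩
      rw [reduction, h1, h2, decide_eq_true hw, decide_eq_true hk, List.all_eq_true.2]
      · rfl
      · intro e he
        simp [hv e he]
    · rintro ⟨r, hr, hs, heq⟩
      have hne : reduction ρ pat nd x ≠ ([], 0) := by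
        rw [heq]
        simp [encRep, unaryCode]
      rw [reduction] at heq hne
      generalize (decodeNums x.1).headD 0 = n at heq hne
      generalize decEdges (decodeNums x.1) = ed at heq hne
      generalize hb : (decide (x.1 = unaryCode (graphNums n ed)) && (decide (1 ≤ x.2) &&
        ed.all fun e => decide (e.1 < n) && (decide (e.2 < n) && !decide (e.1 = e.2)))) = b
        at heq hne
      cases b with
      | false => exact absurd rfl hne
      | true =>
        simp only [Bool.and_eq_true, decide_eq_true_eq, List.all_eq_true, Bool.not_eq_true',
          decide_eq_false_iff_not] at hb
        refine ⟨hb.2.1, n, ed, hb.1, hb.2.2, ?_⟩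
        -- Valid instances are determined by their codes, so `r` is the instance that the reduction
        -- built.
        have h1 := congrArg (fun y => decRep (arities Γ) y.1) heq
        simp only [cond_true, decRep_encRep hr, decRep_encRep (validRep_indepRep hg n x.2 ed)] at h1
        rw [← repSat_indepRep hg, h1]
        exact hs
  · rw [reduction]
    generalize (_ && _ : Bool) = b
    cases b
    · exact Nat.zero_le _
    · exact le_rfl

end UDCSP

theorem mainTheorem7 (Γ : UDCSP.Language 2) :
    (UDCSP.WeaklyZeroSeparable Γ → UDCSP.FPT (UDCSP.OneHotCSP Γ)) ∧
      (¬ UDCSP.WeaklyZeroSeparable Γ → UDCSP.W1Hard (UDCSP.OneHotCSP Γ)) :=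
  ⟨UDCSP.fpt_of_weaklyZeroSeparable, UDCSP.w1Hard_of_not_weaklyZeroSeparable⟩
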